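/- Let $M\ge 3$, $K\ge 2$, $\sigma>0$. A base station with $M$ antennas serves $K$ single-antenna users whose channel vectors $h_1,\dots,h_K\in\mathbb C^M$ have i.i.d. circularly symmetric complex Gaussian entries with mean $0$ and variance $1$; the receiver noise has variance $\sigma^2$. In norm-based user selection (NUS) with $K_s=2$, the users are sorted in descending order of $\|h_k\|$ and the two strongest are selected; call their channels $h_{(1)},h_{(2)}$, $\|h_{(1)}\|\ge\|h_{(2)}\|$, and let $\theta_1\in[0,\pi/2]$ be the angle between $h_{(1)}$ and the line spanned by $h_{(2)}$. Put $$G(M,x)=\frac1{\Gamma(M)}\int_0^x e^{-t}t^{M-1}\,dt,\qquad \alpha_{M,K}=\int_0^\infty K\,\frac{e^{-x}x^{M-2}}{\Gamma(M)}\,G(M,x)^{K-1}\,dx .$$ For channels $g_1,\dots,g_n$ of the users in a given order, noise variance $\sigma^2$ and a common SINR target $\gamma>0$, the large-SINR expression of the minimum instantaneous transmit power is $\sigma^2\sum_{i=1}^{n}\frac{\gamma}{\|g_i\|^2\sin^2\theta_{i-1}}$, where $\theta_{i-1}$ is the angle between $g_i$ and the span of $g_1,\dots,g_{i-1}$ (and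 $\theta_0=\pi/2$). The exact minimum instantaneous transmit power $p_{\min}(\gamma)$ is the infimum of $\sum_k p_k$ over all encoding orders $\pi$, unit beamforming vectors $v_k$ and powers $p_k>0$ with $$\frac{p_k|g_k^\dagger v_k|^2}{\sum_{j:\,\pi(j)<\pi(k)}p_j|g_k^\dagger v_j|^2+\sigma^2}\ \ge\ \gamma\qquad\text{for all }k .$$ Then, for the two users selected by NUS: 1. For every $\gamma>0$ the large-SINR minimum transmit power, with the weaker user first ($g_1=h_{(2)}$, $g_2=h_{(1)}$), is integrable and its average is $$p_{\mathrm N}(2)=\gamma\sigma^2\Bigl(K\alpha_{M,K-1}-\bigl(K-2-\tfrac1{M-2}\bigr)\alpha_{M,K}\Bigr).$$ 2. The exact minimum transmit power $p_{\min}(\gamma)$ is integrable for every $\gamma>0$, and its average agrees with this expression for large SINR targets: $$\lim_{\gamma\to\infty}\frac{\mathbb E[p_{\min}(\gamma)]}{\gamma}=\sigma^2\Bigl(K\alpha_{M,K-1}-\bigl(K-2-\tfrac1{M-2}\bigr)\alpha_{M,K}\Bigr).$$ 3. The following expectations are finite and have the stated values: $\mathbb E\bigl[1/\|h_{(1)}\|^2\bigr]=\alpha_{M,K}$,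 $\ \mathbb E\bigl[1/\|h_{(2)}\|^2\bigr]=K\alpha_{M,K-1}-(K-1)\alpha_{M,K}$, $\ \mathbb E\bigl[1/\sin^2\theta_1\bigr]=\frac{M-1}{M-2}$. -/

import Mathlib

open MeasureTheory ProbabilityTheory Filter Topology

noncomputable section

namespace MultiuserDownlink

/-- The circularly symmetric complex Gaussian law with zero mean and unit variance: real and
imaginary parts are independent real Gaussians with mean `0` and variance `1 / 2`. -/
def stdComplexGaussian : Measure ℂ :=
  ((gaussianReal 0 (1 / 2)).prod (gaussianReal 0 (1 / 2))).map
    (fun z : ℝ × ℝ => (z.1 : ℂ) + (z.2 : ℂ) * Complex.I)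

/-- The regularized (lower) Gamma function `G(M, x)`. -/
def regGamma (M : ℕ) (x : ℝ) : ℝ :=
  1 / Real.Gamma M * ∫ t in (0 : ℝ)..x, Real.exp (-t) * t ^ (M - 1)

/-- The constant `α_{M,K}` (used for `2 ≤ M` and `1 ≤ K`). -/
def alpha (M K : ℕ) : ℝ :=
  ∫ x in Set.Ioi (0 : ℝ),
    (K : ℝ) * (Real.exp (-x) * x ^ (M - 2) / Real.Gamma M) * regGamma M x ^ (K - 1)

/-- Norm-based user selection: the users are sorted in descending order of their channel norms and
the channels of the first `Ks` users are kept, the strongest one having index `0`. (Ties are broken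
in favour of the smaller user index.) -/
def normBasedSelection {M K Ks : ℕ} (hKs : Ks ≤ K) (h : Fin K → EuclideanSpace ℂ (Fin M)) :
    Fin Ks → EuclideanSpace ℂ (Fin M) :=
  fun i => h (Tuple.sort (fun k => -‖h k‖) (Fin.castLE hKs i))

/-- The angle in `[0, π / 2]` that the vector `x` makes with the subspace `U`; it is `π / 2` for
`U = ⊥`. -/
def angleToSubspace {M : ℕ} (x : EuclideanSpace ℂ (Fin M))
    (U : Submodule ℂ (EuclideanSpace ℂ (Fin M))) : ℝ :=
  Real.arccos (‖U.starProjection x‖ / ‖x‖)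

/-- The subspace spanned by the channels which precede that of user `i`. -/
def interferenceSubspace {M n : ℕ} (g : Fin n → EuclideanSpace ℂ (Fin M)) (i : Fin n) :
    Submodule ℂ (EuclideanSpace ℂ (Fin M)) :=
  Submodule.span ℂ (g '' {j | j < i})

/-- The minimum instantaneous transmit power in the large-SINR regime for users listed in the
order `0, 1, …, n - 1`, user `i` facing the interference of the users `j < i`. -/
def largeSINRPower {M n : ℕ} (noise γ : ℝ) (g : Fin n → EuclideanSpace ℂ (Fin M)) : ℝ :=
  noise * ∑ i, γ / (‖g i‖ ^ 2 * Real.sin (angleToSubspace (g i) (interferenceSubspace g i)) ^ 2)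

/-- The SINR of user `k` in the downlink with unit beamforming vectors `v`, powers `p` and
successive (dirty paper) encoding: user `k` is only interfered by the streams of the users `j`
with `π j < π k`. -/
def sinr {M n : ℕ} (noise : ℝ) (g : Fin n → EuclideanSpace ℂ (Fin M)) (π : Equiv.Perm (Fin n))
    (v : Fin n → EuclideanSpace ℂ (Fin M)) (p : Fin n → ℝ) (k : Fin n) : ℝ :=
  p k * ‖inner ℂ (g k) (v k)‖ ^ 2 /
    ((∑ j with π j < π k, p j * ‖inner ℂ (g k) (v j)‖ ^ 2) + noise)

/-- The exact minimum instantaneous transmit power which gives every one of the users with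
channels `g` an SINR of at least `γ`, over all encoding orders, normalized beamforming vectors and
positive power allocations. -/
def minTransmitPower {M n : ℕ} (noise γ : ℝ) (g : Fin n → EuclideanSpace ℂ (Fin M)) : ℝ :=
  sInf {T : ℝ | ∃ (π : Equiv.Perm (Fin n)) (v : Fin n → EuclideanSpace ℂ (Fin M))
    (p : Fin n → ℝ), (∀ k, ‖v k‖ = 1) ∧ (∀ k, 0 < p k) ∧
      (∀ k, γ ≤ sinr noise g π v p k) ∧ T = ∑ k, p k}

end MultiuserDownlink

end

/-!
The formulas combine the law of the order statistics of the channel norms with the isotropy of the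
complex Gaussian law.

The squared modulus of a standard complex Gaussian variable is exponential (polar coordinates), so
`‖h‖²` has the Gamma density `e ^ (-s) * s ^ (M - 1) / (M - 1)!`
(`lintegral_pi_stdComplexGaussian_sum_normSq`) and `G(M, ·)` is its distribution function
(`gaussianVector_norm_lt`). The norms are almost surely distinct, and on the event that `i` is the
strongest and `j` the second strongest user the selected channels are `h i` and `h j`. Integrating
over these events gives the law of the strongest channel (`lintegral_pi_sort_zero`) and the joint
law of the two strongest ones (`lintegral_pi_sort_zero_one`). The expectations of `1 / ‖h₍₁₎‖²` and
`1 / ‖h₍₂₎‖²` are then one-dimensional integrals which are recognized as combinations of the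
constants `alpha`.

For the angle, a unitary map moves the line of `h₍₂₎` to the first coordinate axis without changing
the Gaussian law of the other vector (`map_gaussianVector`). Writing its squared norm as `a + b`,
with `a` the squared modulus of the first coordinate, one has `1 / sin² θ = (a + b) / b`, and for
fixed `s = a + b` the variable `b` has density proportional to `b ^ (M - 2)` on `(0, s)`. Hence
integrating out `1 / sin² θ` yields the constant `(M - 1) / (M - 2)`, even against an arbitrary
function of the norm (`lintegral_gaussianVector_div_sinSq`). The selection depends on the norms
only, so the factorization persists for the selected pair (`lintegral_strongest_div_sinSq`).

For two users the exact minimum power is explicit. If the first encoded user has channel `a` and the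
other one `b`, with `u = b / ‖b‖`, the Cauchy-Schwarz inequality for the inner product given by
`1 + γ u u†` shows that the least power is
`γσ² (1 / ‖b‖² + 1 / (‖a‖² (1 - γ / (1 + γ) cos² θ)))`,
and this is smallest when `a` is the stronger channel (`minTransmitPower_eq_pairPower`). Divided by
`γ` it increases to the large-SINR expression as `γ → ∞`, so that dominated convergence gives the
limit of the expectations.
-/

noncomputable section

namespace MultiuserDownlink

open scoped ENNReal

/-! ### The squared modulus of a complex Gaussian variable -/

instance : IsProbabilityMeasure stdComplexGaussian := by
  unfold stdComplexGaussian
  exact Measure.isProbabilityMeasure_map (by fun_prop)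

lemma lintegral_stdComplexGaussian {f : ℂ → ℝ≥0∞} (hf : Measurable f) :
    ∫⁻ z, f z ∂stdComplexGaussian =
      ∫⁻ z, ENNReal.ofReal (Real.pi⁻¹ * Real.exp (-‖z‖ ^ 2)) * f z := by
  have hv : (1 / 2 : NNReal) ≠ 0 := by norm_num
  rw [stdComplexGaussian, lintegral_map hf (by fun_prop),
    gaussianReal_of_var_ne_zero _ hv, prod_withDensity (by fun_prop) (by fun_prop),
    lintegral_withDensity_eq_lintegral_mul _ (by fun_prop) (by fun_prop),
    ← (Complex.volume_preserving_equiv_real_prod.symm).lintegral_comp_emb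
      Complex.measurableEquivRealProd.symm.measurableEmbedding]
  refine lintegral_congr fun z => ?_
  have e : Complex.measurableEquivRealProd.symm z = (z.1 : ℂ) + (z.2 : ℂ) * Complex.I := by
    apply Complex.ext <;> simp [Complex.measurableEquivRealProd]
  rw [e, Pi.mul_apply]
  congr 1
  rw [gaussianPDF, gaussianPDF, ← ENNReal.ofReal_mul (gaussianPDFReal_nonneg _ _ _)]
  congr 1
  rw [gaussianPDFReal, gaussianPDFReal, ← Complex.normSq_eq_norm_sq, Complex.normSq_add_mul_I]
  have h2 : (√(2 * Real.pi * ((1 / 2 : NNReal) : ℝ)))⁻¹ *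
      (√(2 * Real.pi * ((1 / 2 : NNReal) : ℝ)))⁻¹ = Real.pi⁻¹ := by
    rw [← mul_inv, Real.mul_self_sqrt (by positivity)]
    congr 1
    push_cast
    ring
  rw [mul_mul_mul_comm, h2, ← Real.exp_add]
  congr 2
  push_cast
  ring

/-- The squared modulus of a standard complex Gaussian variable is exponentially distributed. -/
lemma lintegral_stdComplexGaussian_normSq {φ : ℝ → ℝ≥0∞} (hφ : Measurable φ) :
    ∫⁻ z, φ (‖z‖ ^ 2) ∂stdComplexGaussian =
      ∫⁻ s in Set.Ioi (0 : ℝ), ENNReal.ofReal (Real.exp (-s)) * φ s := by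
  rw [lintegral_stdComplexGaussian (by fun_prop), ← Complex.lintegral_comp_polarCoord_symm]
  have e : polarCoord.target = Set.Ioi (0 : ℝ) ×ˢ Set.Ioo (-Real.pi) Real.pi := rfl
  rw [e, Measure.volume_eq_prod, setLIntegral_prod _ (by
    apply Measurable.aemeasurable
    simp only [Complex.norm_polarCoord_symm, smul_eq_mul]
    fun_prop)]
  simp only [Complex.norm_polarCoord_symm, lintegral_const, sq_abs, smul_eq_mul]
  -- after integrating out the argument, substitute `s = r ^ 2`
  have him : (fun r : ℝ => r ^ 2) '' Set.Ioi 0 = Set.Ioi 0 := by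
    ext s
    constructor
    · rintro ⟨r, hr, rfl⟩
      have : (0 : ℝ) < r := hr
      exact pow_pos this 2
    · intro hs
      exact ⟨√s, Real.sqrt_pos.2 hs, Real.sq_sqrt (le_of_lt hs)⟩
  have hcv := lintegral_image_eq_lintegral_abs_deriv_mul (s := Set.Ioi (0 : ℝ))
    (f := fun r => r ^ 2) (f' := fun r => 2 * r) measurableSet_Ioi
    (fun x _ => by simpa using (hasDerivAt_pow 2 x).hasDerivWithinAt)
    (fun x hx y hy hxy => by
      have hx : (0 : ℝ) < x := hx
      have hy : (0 : ℝ) < y := hy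
      exact (pow_left_inj₀ hx.le hy.le two_ne_zero).1 hxy)
    (fun s => ENNReal.ofReal (Real.exp (-s)) * φ s)
  rw [him] at hcv
  rw [hcv]
  refine setLIntegral_congr_fun measurableSet_Ioi fun r hr => ?_
  have hr : (0 : ℝ) < r := hr
  simp only [Measure.restrict_apply_univ, Real.volume_Ioo]
  rw [abs_of_pos (by positivity : (0 : ℝ) < 2 * r), ← mul_assoc (ENNReal.ofReal r),
    mul_right_comm _ (φ _), ← mul_assoc (ENNReal.ofReal (2 * r)),
    ← ENNReal.ofReal_mul (by positivity), ← ENNReal.ofReal_mul (by positivity),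
    ← ENNReal.ofReal_mul (by positivity)]
  congr 2
  field_simp
  ring

/-! ### Sums of exponential variables -/

/-- Change of variables `s = a + b` in the positive quadrant. -/
lemma lintegral_Ioi_Ioi_add {G : ℝ → ℝ → ℝ≥0∞} (hG : Measurable (Function.uncurry G)) :
    ∫⁻ a in Set.Ioi (0 : ℝ), ∫⁻ b in Set.Ioi (0 : ℝ), G (a + b) b =
      ∫⁻ s in Set.Ioi (0 : ℝ), ∫⁻ b in Set.Ioo 0 s, G s b := by
  have hG' : Measurable fun p : ℝ × ℝ => G p.1 p.2 := hG
  rw [lintegral_lintegral_swap (by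
    apply Measurable.aemeasurable
    exact hG'.comp (by fun_prop : Measurable fun p : ℝ × ℝ => (p.1 + p.2, p.2)))]
  have h1 : ∀ b : ℝ, ∫⁻ a in Set.Ioi (0 : ℝ), G (a + b) b =
      ∫⁻ s, (Set.Ioi b).indicator (fun s => G s b) s := by
    intro b
    rw [← lintegral_indicator measurableSet_Ioi,
      ← lintegral_add_right_eq_self (fun s => (Set.Ioi b).indicator (fun s => G s b) s) b]
    refine lintegral_congr fun a => ?_
    simp [Set.indicator]
  simp_rw [h1]
  rw [lintegral_lintegral_swap]
  · rw [← lintegral_indicator measurableSet_Ioi]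
    refine lintegral_congr fun s => ?_
    by_cases hs : 0 < s
    · rw [Set.indicator_of_mem (show s ∈ Set.Ioi 0 from hs),
        ← lintegral_indicator measurableSet_Ioi,
        ← lintegral_indicator measurableSet_Ioo]
      refine lintegral_congr fun b => ?_
      by_cases hb : 0 < b <;> by_cases hbs : b < s <;> simp [Set.indicator, hb, hbs]
    · rw [Set.indicator_of_notMem (show s ∉ Set.Ioi 0 from hs)]
      rw [← lintegral_indicator measurableSet_Ioi]
      refine (lintegral_congr fun b => ?_).trans lintegral_zero
      by_cases hb : 0 < b
      · have : ¬ b < s := fun h => hs (hb.trans h)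
        simp [Set.indicator, this]
      · simp [Set.indicator, hb]
  · apply Measurable.aemeasurable
    have : (Function.uncurry fun b s : ℝ => (Set.Ioi b).indicator (fun s => G s b) s) =
        {p : ℝ × ℝ | p.1 < p.2}.indicator (fun p => G p.2 p.1) := by
      ext ⟨b, s⟩
      simp [Set.indicator, Function.uncurry]
    rw [this]
    exact (hG'.comp measurable_swap).indicator (measurableSet_lt measurable_fst measurable_snd)

lemma lintegral_Ioo_pow (n : ℕ) {s : ℝ} (hs : 0 < s) :
    ∫⁻ b in Set.Ioo 0 s, ENNReal.ofReal (b ^ n) = ENNReal.ofReal (s ^ (n + 1) / (n + 1)) := by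
  rw [← ofReal_integral_eq_lintegral_ofReal]
  · rw [← integral_Ioc_eq_integral_Ioo, ← intervalIntegral.integral_of_le hs.le, integral_pow]
    simp
  · exact (continuous_pow n).integrableOn_Icc.mono_set Set.Ioo_subset_Icc_self
  · filter_upwards [ae_restrict_mem measurableSet_Ioo] with b hb
    exact pow_nonneg hb.1.le n

/-- Splitting off the first coordinate of a Gaussian vector. -/
lemma lintegral_pi_stdComplexGaussian_succ (n : ℕ) {f : ℝ → ℝ → ℝ≥0∞}
    (hf : Measurable (Function.uncurry f)) :
    ∫⁻ z : Fin (n + 1) → ℂ, f (‖z 0‖ ^ 2) (∑ i : Fin n, ‖z i.succ‖ ^ 2)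
        ∂(Measure.pi fun _ => stdComplexGaussian) =
      ∫⁻ a in Set.Ioi (0 : ℝ), ENNReal.ofReal (Real.exp (-a)) *
        ∫⁻ z : Fin n → ℂ, f a (∑ i, ‖z i‖ ^ 2) ∂(Measure.pi fun _ => stdComplexGaussian) := by
  have hmp := measurePreserving_piFinSuccAbove (fun _ : Fin (n + 1) => stdComplexGaussian) 0
  have hf' : Measurable fun p : ℝ × ℝ => f p.1 p.2 := hf
  have hm : Measurable fun p : ℂ × (Fin n → ℂ) => f (‖p.1‖ ^ 2) (∑ i, ‖p.2 i‖ ^ 2) :=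
    hf'.comp (by fun_prop : Measurable fun p : ℂ × (Fin n → ℂ) => (‖p.1‖ ^ 2, ∑ i, ‖p.2 i‖ ^ 2))
  have h1 := hmp.lintegral_comp hm
  simp only [MeasurableEquiv.piFinSuccAbove_apply, Fin.insertNthEquiv_symm_apply,
    Fin.removeNth_apply, Fin.zero_succAbove] at h1
  rw [h1, lintegral_prod _ hm.aemeasurable]
  refine lintegral_stdComplexGaussian_normSq
    (φ := fun a => ∫⁻ z : Fin n → ℂ, f a (∑ i, ‖z i‖ ^ 2)
      ∂(Measure.pi fun _ => stdComplexGaussian)) ?_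
  exact Measurable.lintegral_prod_right' (f := fun p : ℝ × (Fin n → ℂ) => f p.1 (∑ i, ‖p.2 i‖ ^ 2))
    (hf'.comp (by fun_prop : Measurable fun p : ℝ × (Fin n → ℂ) => (p.1, ∑ i, ‖p.2 i‖ ^ 2)))

/-- The squared norm of a vector of `n + 1` independent standard complex Gaussian variables has
the Gamma density `e ^ (-s) * s ^ n / n!`. -/
lemma lintegral_pi_stdComplexGaussian_sum_normSq (n : ℕ) {φ : ℝ → ℝ≥0∞} (hφ : Measurable φ) :
    ∫⁻ z : Fin (n + 1) → ℂ, φ (∑ i, ‖z i‖ ^ 2) ∂(Measure.pi fun _ => stdComplexGaussian) =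
      ∫⁻ s in Set.Ioi (0 : ℝ), ENNReal.ofReal (Real.exp (-s) * s ^ n / n.factorial) * φ s := by
  induction n generalizing φ with
  | zero =>
    have h := lintegral_pi_stdComplexGaussian_succ 0 (f := fun a b => φ (a + b)) (by fun_prop)
    simp only [Fin.sum_univ_succ]
    rw [h]
    simp
  | succ n ih =>
    have h := lintegral_pi_stdComplexGaussian_succ (n + 1) (f := fun a b => φ (a + b)) (by fun_prop)
    simp only [Fin.sum_univ_succ (n := n + 1)]
    rw [h]
    have h2 : ∀ a : ℝ, ENNReal.ofReal (Real.exp (-a)) *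
        ∫⁻ z : Fin (n + 1) → ℂ, φ (a + ∑ i, ‖z i‖ ^ 2)
          ∂(Measure.pi fun _ => stdComplexGaussian) =
        ∫⁻ b in Set.Ioi (0 : ℝ), ENNReal.ofReal (Real.exp (-(a + b)) / n.factorial) * φ (a + b) *
          ENNReal.ofReal (b ^ n) := by
      intro a
      rw [ih (φ := fun b => φ (a + b)) (by fun_prop), ← lintegral_const_mul _ (by fun_prop)]
      refine setLIntegral_congr_fun measurableSet_Ioi fun b hb => ?_
      have hb : (0 : ℝ) < b := hb
      rw [← mul_assoc, mul_right_comm (ENNReal.ofReal _) (φ _),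
        ← ENNReal.ofReal_mul (by positivity),
        ← ENNReal.ofReal_mul (by positivity)]
      congr 2
      rw [neg_add, Real.exp_add]
      ring
    simp_rw [h2]
    rw [lintegral_Ioi_Ioi_add (G := fun s b => ENNReal.ofReal (Real.exp (-s) / n.factorial) * φ s *
          ENNReal.ofReal (b ^ n)) (by fun_prop)]
    refine setLIntegral_congr_fun measurableSet_Ioi fun s hs => ?_
    have hs : (0 : ℝ) < s := hs
    rw [lintegral_const_mul _ (by fun_prop), lintegral_Ioo_pow n hs, mul_right_comm,
      ← ENNReal.ofReal_mul (by positivity)]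
    congr 2
    rw [Nat.factorial_succ]
    push_cast
    field_simp

/-- The weight `(a + b) / b`, where `a` is the squared modulus of the first coordinate and `b` the
sum of the others, is the reciprocal squared sine of the angle to the first axis. Integrating it out
only produces a constant, whatever function of the norm it is multiplied with. -/
lemma lintegral_pi_stdComplexGaussian_div (n : ℕ) {φ : ℝ → ℝ≥0∞} (hφ : Measurable φ) :
    ∫⁻ z : Fin (n + 3) → ℂ, φ (∑ i, ‖z i‖ ^ 2) *
        (ENNReal.ofReal (∑ i, ‖z i‖ ^ 2) / ENNReal.ofReal (∑ i : Fin (n + 2), ‖z i.succ‖ ^ 2))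
        ∂(Measure.pi fun _ => stdComplexGaussian) =
      ENNReal.ofReal ((n + 2) / (n + 1)) *
        ∫⁻ z : Fin (n + 3) → ℂ, φ (∑ i, ‖z i‖ ^ 2) ∂(Measure.pi fun _ => stdComplexGaussian) := by
  have h := lintegral_pi_stdComplexGaussian_succ (n + 2)
    (f := fun a b => φ (a + b) * (ENNReal.ofReal (a + b) / ENNReal.ofReal b)) (by fun_prop)
  rw [lintegral_pi_stdComplexGaussian_sum_normSq (n + 2) hφ]
  simp only [Fin.sum_univ_succ (n := n + 2)]
  rw [h]
  have h2 : ∀ a ∈ Set.Ioi (0 : ℝ), ENNReal.ofReal (Real.exp (-a)) *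
        ∫⁻ z : Fin (n + 2) → ℂ, φ (a + ∑ i, ‖z i‖ ^ 2) *
          (ENNReal.ofReal (a + ∑ i, ‖z i‖ ^ 2) / ENNReal.ofReal (∑ i, ‖z i‖ ^ 2))
          ∂(Measure.pi fun _ => stdComplexGaussian) =
      ∫⁻ b in Set.Ioi (0 : ℝ), ENNReal.ofReal (Real.exp (-(a + b)) * (a + b) / (n + 1).factorial) *
        φ (a + b) * ENNReal.ofReal (b ^ n) := by
    intro a ha
    have ha : (0 : ℝ) < a := ha
    rw [lintegral_pi_stdComplexGaussian_sum_normSq (n + 1)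
      (φ := fun b => φ (a + b) * (ENNReal.ofReal (a + b) / ENNReal.ofReal b)) (by fun_prop),
      ← lintegral_const_mul _ (by fun_prop)]
    refine setLIntegral_congr_fun measurableSet_Ioi fun b hb => ?_
    have hb : (0 : ℝ) < b := hb
    rw [← ENNReal.ofReal_div_of_pos hb, ← mul_assoc, mul_left_comm,
      mul_right_comm (ENNReal.ofReal _) (φ _), mul_comm (φ _),
      ← ENNReal.ofReal_mul (by positivity), ← ENNReal.ofReal_mul (by positivity),
      ← ENNReal.ofReal_mul (by positivity)]
    congr 2
    rw [neg_add, Real.exp_add]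
    field_simp
    ring
  rw [setLIntegral_congr_fun measurableSet_Ioi h2,
    lintegral_Ioi_Ioi_add (G := fun s b => ENNReal.ofReal (Real.exp (-s) * s / (n + 1).factorial) *
      φ s * ENNReal.ofReal (b ^ n)) (by fun_prop), ← lintegral_const_mul _ (by fun_prop)]
  refine setLIntegral_congr_fun measurableSet_Ioi fun s hs => ?_
  have hs : (0 : ℝ) < s := hs
  rw [lintegral_const_mul _ (by fun_prop), lintegral_Ioo_pow n hs, mul_right_comm,
    ← ENNReal.ofReal_mul (by positivity), ← mul_assoc, ← ENNReal.ofReal_mul (by positivity)]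
  congr 2
  rw [Nat.factorial_succ (n + 1)]
  push_cast
  field_simp
  ring

/-! ### Unitary invariance of the Gaussian channel vector -/

/-- The law of a vector in `ℂ^M` with independent standard complex Gaussian entries. -/
def gaussianVector (M : ℕ) : Measure (EuclideanSpace ℂ (Fin M)) :=
  (Measure.pi fun _ : Fin M => stdComplexGaussian).map (WithLp.toLp 2)

instance (M : ℕ) : IsProbabilityMeasure (gaussianVector M) := by
  unfold gaussianVector
  exact Measure.isProbabilityMeasure_map (by fun_prop)

lemma lintegral_gaussianVector {M : ℕ} {f : EuclideanSpace ℂ (Fin M) → ℝ≥0∞} (hf : Measurable f) :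
    ∫⁻ x, f x ∂(gaussianVector M) =
      ∫⁻ z, f (WithLp.toLp 2 z) ∂(Measure.pi fun _ => stdComplexGaussian) := by
  rw [gaussianVector, lintegral_map hf (by fun_prop)]

lemma charFun_stdComplexGaussian (t : ℂ) :
    charFun stdComplexGaussian t = Complex.exp (-((‖t‖ ^ 2 : ℝ) : ℂ) / 4) := by
  rw [charFun_apply, stdComplexGaussian, integral_map (by fun_prop) (by fun_prop)]
  have h : ∀ z : ℝ × ℝ, Complex.exp (inner ℝ ((z.1 : ℂ) + (z.2 : ℂ) * Complex.I) t * Complex.I) =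
      Complex.exp (t.re * z.1 * Complex.I) * Complex.exp (t.im * z.2 * Complex.I) := by
    intro z
    rw [← Complex.exp_add, Complex.inner]
    congr 1
    simp
    ring
  simp_rw [h]
  rw [integral_prod_mul (fun x : ℝ => Complex.exp (t.re * x * Complex.I))
    (fun x : ℝ => Complex.exp (t.im * x * Complex.I)), ← charFun_apply_real, ← charFun_apply_real,
    charFun_gaussianReal, charFun_gaussianReal, ← Complex.exp_add, ← Complex.normSq_eq_norm_sq,
    Complex.normSq_apply]
  congr 1
  push_cast
  ring

lemma charFun_gaussianVector {M : ℕ} (t : PiLp 2 fun _ : Fin M => ℂ) :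
    charFun (E := PiLp 2 fun _ : Fin M => ℂ) (gaussianVector M) t =
      Complex.exp (-((‖t‖ ^ 2 : ℝ) : ℂ) / 4) := by
  rw [gaussianVector, charFun_pi]
  simp_rw [charFun_stdComplexGaussian]
  rw [← Complex.exp_sum, EuclideanSpace.norm_sq_eq]
  congr 1
  push_cast
  rw [← Finset.sum_div, Finset.sum_neg_distrib]

lemma map_gaussianVector {M : ℕ} (U : EuclideanSpace ℂ (Fin M) ≃ₗᵢ[ℂ] EuclideanSpace ℂ (Fin M)) :
    (gaussianVector M).map U = gaussianVector M := by
  have : IsProbabilityMeasure ((gaussianVector M).map U) :=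
    Measure.isProbabilityMeasure_map U.continuous.measurable.aemeasurable
  -- characteristic functions refer to the real inner product, which `U` preserves as well
  let V : (PiLp 2 fun _ : Fin M => ℂ) ≃ₗᵢ[ℝ] (PiLp 2 fun _ : Fin M => ℂ) :=
    { toLinearEquiv := U.toLinearEquiv.restrictScalars ℝ
      norm_map' := U.norm_map }
  refine Measure.ext_of_charFun (E := PiLp 2 fun _ : Fin M => ℂ) (funext fun t => ?_)
  rw [charFun_gaussianVector, charFun_apply,
    integral_map U.continuous.measurable.aemeasurable (by fun_prop)]
  have h : ∀ x : PiLp 2 fun _ : Fin M => ℂ, inner ℝ (U x) t = inner ℝ x (V.symm t) := by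
    intro x
    conv_lhs => rw [← V.apply_symm_apply t]
    exact V.inner_map_map x (V.symm t)
  simp_rw [h]
  rw [← charFun_apply, charFun_gaussianVector, V.symm.norm_map]

/-! ### The angle between a Gaussian vector and a fixed line -/

/-- The squared cosine of the angle between two complex lines (`0` if one of the vectors is `0`). -/
def cosSq {M : ℕ} (x y : EuclideanSpace ℂ (Fin M)) : ℝ :=
  ‖inner ℂ y x‖ ^ 2 / (‖y‖ ^ 2 * ‖x‖ ^ 2)

lemma cosSq_nonneg {M : ℕ} (x y : EuclideanSpace ℂ (Fin M)) : 0 ≤ cosSq x y := by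
  unfold cosSq; positivity

lemma cosSq_le_one {M : ℕ} (x y : EuclideanSpace ℂ (Fin M)) : cosSq x y ≤ 1 := by
  unfold cosSq
  refine div_le_one_of_le₀ ?_ (by positivity)
  rw [← mul_pow]
  exact pow_le_pow_left₀ (norm_nonneg _) (norm_inner_le_norm y x) 2

lemma cosSq_comm {M : ℕ} (x y : EuclideanSpace ℂ (Fin M)) : cosSq x y = cosSq y x := by
  unfold cosSq
  rw [norm_inner_symm, mul_comm]

@[fun_prop]
lemma measurable_cosSq {M : ℕ} : Measurable
    fun p : EuclideanSpace ℂ (Fin M) × EuclideanSpace ℂ (Fin M) => cosSq p.1 p.2 := by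
  unfold cosSq
  fun_prop

lemma sin_angleToSubspace_span_singleton_sq {M : ℕ} (x y : EuclideanSpace ℂ (Fin M)) :
    Real.sin (angleToSubspace x (Submodule.span ℂ {y})) ^ 2 = 1 - cosSq x y := by
  have hc : (‖(Submodule.span ℂ {y}).starProjection x‖ / ‖x‖) ^ 2 = cosSq x y := by
    rw [Submodule.starProjection_singleton, norm_smul, cosSq]
    by_cases hy : ‖y‖ = 0
    · simp [hy]
    by_cases hx : ‖x‖ = 0
    · simp [hx]
    rw [norm_div]
    simp
    field_simp
  rw [angleToSubspace, Real.sin_arccos, hc, Real.sq_sqrt (sub_nonneg.2 (cosSq_le_one x y))]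

lemma lintegral_gaussianVector_normSq (n : ℕ) {φ : ℝ → ℝ≥0∞} (hφ : Measurable φ) :
    ∫⁻ x, φ (‖x‖ ^ 2) ∂(gaussianVector (n + 1)) =
      ∫⁻ s in Set.Ioi (0 : ℝ), ENNReal.ofReal (Real.exp (-s) * s ^ n / n.factorial) * φ s := by
  rw [lintegral_gaussianVector (by fun_prop), ← lintegral_pi_stdComplexGaussian_sum_normSq n hφ]
  simp [EuclideanSpace.norm_sq_eq]

lemma gaussianVector_norm_eq (n : ℕ) (r : ℝ) : gaussianVector (n + 1) {x | ‖x‖ = r} = 0 := by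
  have h := lintegral_gaussianVector_normSq n
    (φ := Set.indicator {r ^ 2} 1) (measurable_one.indicator (measurableSet_singleton _))
  have h2 : ∫⁻ s in Set.Ioi (0 : ℝ), ENNReal.ofReal (Real.exp (-s) * s ^ n / n.factorial) *
      Set.indicator {r ^ 2} 1 s = 0 := by
    rw [lintegral_eq_zero_iff (by
      have := (measurable_one (α := ℝ≥0∞) (β := ℝ)).indicator (measurableSet_singleton (r ^ 2))
      fun_prop)]
    filter_upwards [ae_restrict_of_ae (Measure.ae_ne volume (r ^ 2))] with s hs
    simp [Set.indicator, hs]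
  rw [h2] at h
  refine measure_mono_null (t := {x | ‖x‖ ^ 2 = r ^ 2}) (fun x (hx : ‖x‖ = r) => by simp [hx]) ?_
  rw [← lintegral_indicator_one (measurableSet_eq_fun (by fun_prop) (by fun_prop)), ← h]
  refine lintegral_congr fun x => ?_
  simp [Set.indicator]

/-- The direction of a Gaussian vector in `ℂ^M` is independent of its norm, and its angle `θ` to any
fixed line satisfies `𝔼[1 / sin² θ] = (M - 1) / (M - 2)`. The reciprocal is taken in `ℝ≥0∞`, where
it is infinite for `sin θ = 0`, so that the finiteness of the integral has the almost sure
nondegeneracy of the angle as a consequence. -/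
lemma lintegral_gaussianVector_div_sinSq (n : ℕ) {φ : ℝ → ℝ≥0∞} (hφ : Measurable φ)
    {y : EuclideanSpace ℂ (Fin (n + 3))} (hy : y ≠ 0) :
    ∫⁻ x, φ (‖x‖ ^ 2) * (ENNReal.ofReal (1 - cosSq x y))⁻¹ ∂(gaussianVector (n + 3)) =
      ENNReal.ofReal ((n + 2) / (n + 1)) * ∫⁻ x, φ (‖x‖ ^ 2) ∂(gaussianVector (n + 3)) := by
  have hy' : ‖y‖ ≠ 0 := norm_ne_zero_iff.2 hy
  -- a unitary map sends the line of `y` to the first coordinate axis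
  obtain ⟨b, hb⟩ := Orthonormal.exists_orthonormalBasis_extension_of_card_eq (𝕜 := ℂ)
    (E := EuclideanSpace ℂ (Fin (n + 3))) (ι := Fin (n + 3)) (by simp)
    (v := fun _ => (‖y‖ : ℂ)⁻¹ • y) (s := {0}) (by
      constructor
      · intro i
        simp [norm_smul, hy']
      · intro i j hij
        exact absurd (Subsingleton.elim i j) hij)
  have hb0 : b 0 = (‖y‖ : ℂ)⁻¹ • y := hb 0 rfl
  have hcos : ∀ x, cosSq x y = ‖b.repr x 0‖ ^ 2 / ‖b.repr x‖ ^ 2 := by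
    intro x
    rw [b.repr_apply_apply, hb0, b.repr.norm_map, cosSq, inner_smul_left, norm_mul]
    simp
    rw [mul_pow, inv_pow]
    field_simp
  let F : EuclideanSpace ℂ (Fin (n + 3)) → ℝ≥0∞ := fun z =>
    φ (‖z‖ ^ 2) * (ENNReal.ofReal (1 - ‖z 0‖ ^ 2 / ‖z‖ ^ 2))⁻¹
  have hF : Measurable F := by fun_prop
  have h1 : ∫⁻ x, φ (‖x‖ ^ 2) * (ENNReal.ofReal (1 - cosSq x y))⁻¹ ∂(gaussianVector (n + 3)) =
      ∫⁻ z, F z ∂(gaussianVector (n + 3)) := by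
    conv_rhs => rw [← map_gaussianVector b.repr]
    rw [lintegral_map hF b.repr.continuous.measurable]
    refine lintegral_congr fun x => ?_
    simp only [F, hcos, b.repr.norm_map]
  rw [h1, lintegral_gaussianVector hF, lintegral_gaussianVector (by fun_prop)]
  simp only [F, EuclideanSpace.norm_sq_eq]
  rw [← lintegral_pi_stdComplexGaussian_div n hφ]
  have h0 : ∀ᵐ x ∂(gaussianVector (n + 3)), x ≠ 0 := by
    have := gaussianVector_norm_eq (n + 2) 0
    rw [ae_iff]
    simpa using this
  have h0' := ae_of_ae_map (by fun_prop) h0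
  refine lintegral_congr_ae ?_
  filter_upwards [h0'] with z hz
  have hS : ∑ i, ‖z i‖ ^ 2 ≠ 0 := by
    have := EuclideanSpace.norm_sq_eq (WithLp.toLp 2 z)
    simp only at this
    rw [← this]
    exact pow_ne_zero 2 (norm_ne_zero_iff.2 hz)
  congr 1
  have hT : 1 - ‖z 0‖ ^ 2 / ∑ i, ‖z i‖ ^ 2 =
      (∑ i : Fin (n + 2), ‖z i.succ‖ ^ 2) / ∑ i, ‖z i‖ ^ 2 := by
    rw [eq_div_iff hS, sub_mul, div_mul_cancel₀ _ hS, Fin.sum_univ_succ (n := n + 2)]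
    ring
  have hS' : 0 < ∑ i, ‖z i‖ ^ 2 := lt_of_le_of_ne (by positivity) hS.symm
  rw [hT, ENNReal.ofReal_div_of_pos hS', ENNReal.inv_div (Or.inl ENNReal.ofReal_ne_top)
    (Or.inl (ENNReal.ofReal_pos.2 hS').ne')]

/-! ### The two largest of finitely many values -/

lemma measurableSet_sort_eq {n : ℕ} (τ : Equiv.Perm (Fin n)) :
    MeasurableSet {f : Fin n → ℝ | Tuple.sort f = τ} := by
  simp_rw [eq_comm (b := τ), Tuple.eq_sort_iff, Monotone]
  refine measurableSet_setOfPred.2 (Measurable.and ?_ ?_)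
  · exact .forall fun i => .forall fun j => .imp measurable_const
      (measurableSet_setOfPred.1 (measurableSet_le (measurable_pi_apply _) (measurable_pi_apply _)))
  · exact .forall fun i => .forall fun j => .imp measurable_const (.imp
      (measurableSet_setOfPred.1
        (measurableSet_eq_fun (measurable_pi_apply _) (measurable_pi_apply _)))
      measurable_const)

lemma measurable_normBasedSelection {M K Ks : ℕ} (hKs : Ks ≤ K) :
    Measurable (normBasedSelection (M := M) hKs) := by
  refine measurable_pi_lambda _ fun i => ?_
  let : MeasurableSpace (Equiv.Perm (Fin K)) := ⊤
  have hs : Measurable fun h : Fin K → EuclideanSpace ℂ (Fin M) => Tuple.sort fun k => -‖h k‖ := by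
    refine measurable_to_countable' fun τ => ?_
    exact (by fun_prop : Measurable fun (h : Fin K → EuclideanSpace ℂ (Fin M)) k => -‖h k‖)
      (measurableSet_sort_eq τ)
  have he : Measurable fun p : (Fin K → EuclideanSpace ℂ (Fin M)) × Equiv.Perm (Fin K) =>
      p.1 (p.2 (Fin.castLE hKs i)) :=
    measurable_from_prod_countable_left fun τ => measurable_pi_apply (τ (Fin.castLE hKs i))
  exact he.comp (measurable_id.prodMk hs)

lemma norm_normBasedSelection_antitone {M K Ks : ℕ} (hKs : Ks ≤ K)
    (h : Fin K → EuclideanSpace ℂ (Fin M)) {i j : Fin Ks} (hij : i ≤ j) :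
    ‖normBasedSelection hKs h j‖ ≤ ‖normBasedSelection hKs h i‖ := by
  have := Tuple.monotone_sort (fun k => -‖h k‖) (a := Fin.castLE hKs i) (b := Fin.castLE hKs j) hij
  simpa [normBasedSelection] using this

/-- Without ties, index `i` is sorted first iff its value exceeds all the others. -/
lemma sort_neg_zero_eq_iff {n : ℕ} {x : Fin (n + 2) → ℝ} (hinj : Function.Injective x)
    (i : Fin (n + 2)) :
    Tuple.sort (fun k => -x k) 0 = i ↔ ∀ l, x (i.succAbove l) < x i := by
  set τ := Tuple.sort fun k => -x k with hτ
  have hmono : ∀ k, x k ≤ x (τ 0) := by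
    intro k
    have := Tuple.monotone_sort (fun k => -x k) (Fin.zero_le (τ.symm k))
    simpa [← hτ] using this
  constructor
  · rintro rfl l
    exact lt_of_le_of_ne (hmono _) fun he => Fin.succAbove_ne _ _ (hinj he)
  · intro hl
    by_contra hne
    obtain ⟨l, hl'⟩ := Fin.exists_succAbove_eq hne
    have := hl l
    rw [hl'] at this
    exact absurd (hmono i) (not_le.2 this)

/-- Without ties, two indices are sorted first and second iff the value of the second one is below
that of the first one and above all the others. -/
lemma sort_neg_zero_one_eq_iff {n : ℕ} {x : Fin (n + 2) → ℝ} (hinj : Function.Injective x)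
    (i : Fin (n + 2)) (j : Fin (n + 1)) :
    (Tuple.sort (fun k => -x k) 0 = i ∧ Tuple.sort (fun k => -x k) 1 = i.succAbove j) ↔
      x (i.succAbove j) < x i ∧ ∀ l, x (i.succAbove (j.succAbove l)) < x (i.succAbove j) := by
  have h0 := sort_neg_zero_eq_iff hinj i
  set τ := Tuple.sort fun k => -x k with hτ
  have hmono : ∀ k, k ≠ τ 0 → x k ≤ x (τ 1) := by
    intro k hk
    have h1 : (1 : Fin (n + 2)) ≤ τ.symm k := by
      rw [Fin.le_def, Fin.val_one, Nat.one_le_iff_ne_zero]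
      intro h0
      exact hk (by rw [← Fin.ext (a := τ.symm k) (b := 0) h0, τ.apply_symm_apply])
    have := Tuple.monotone_sort (fun k => -x k) h1
    simpa [← hτ] using this
  constructor
  · rintro ⟨hi, hj⟩
    refine ⟨h0.1 hi j, fun l => ?_⟩
    rw [← hj]
    refine lt_of_le_of_ne (hmono _ (by rw [hi]; exact Fin.succAbove_ne _ _)) fun he => ?_
    have := hinj he
    rw [hj] at this
    exact Fin.succAbove_ne _ _ (Fin.succAbove_right_injective this)
  · rintro ⟨hij, hl⟩
    have hi : τ 0 = i := h0.2 fun l => by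
      by_cases hlj : l = j
      · rw [hlj]; exact hij
      · obtain ⟨l', rfl⟩ := Fin.exists_succAbove_eq hlj
        exact (hl l').trans hij
    refine ⟨hi, ?_⟩
    have h1i : τ 1 ≠ i := by
      rw [← hi]
      exact fun he => absurd (τ.injective he) (by simp)
    obtain ⟨l, hl'⟩ := Fin.exists_succAbove_eq h1i
    by_contra hne
    have hlj : l ≠ j := fun he => hne (by rw [← hl', he])
    obtain ⟨l', rfl⟩ := Fin.exists_succAbove_eq hlj
    have h2 := hl l'
    rw [hl'] at h2
    exact absurd (hmono (i.succAbove j) (by rw [hi]; exact Fin.succAbove_ne _ _)) (not_le.2 h2)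

/-! ### Integrals over the largest members of an i.i.d. family -/

section OrderStatistics

variable {E : Type*} [MeasurableSpace E] (μ : Measure E) [IsProbabilityMeasure μ] {N : E → ℝ}
  {n : ℕ}

lemma ae_pi_injective_comp (hN : Measurable N) (hμ : ∀ r : ℝ, μ {x | N x = r} = 0) (K : ℕ) :
    ∀ᵐ h ∂(Measure.pi fun _ : Fin K => μ), Function.Injective fun k => N (h k) := by
  have key : ∀ i j : Fin K, i ≠ j → ∀ᵐ h ∂(Measure.pi fun _ : Fin K => μ), N (h i) ≠ N (h j) := by
    intro i j hij
    have hind : IndepFun (fun h : Fin K → E => h i) (fun h => h j)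
        (Measure.pi fun _ : Fin K => μ) :=
      (iIndepFun_pi (X := fun _ x => x) (fun _ => aemeasurable_id)).indepFun hij
    have hmap := (indepFun_iff_map_prod_eq_prod_map_map (measurable_pi_apply i).aemeasurable
      (measurable_pi_apply j).aemeasurable).1 hind
    have e : ∀ k : Fin K, Measure.map (fun h : Fin K → E => h k)
        (Measure.pi fun _ : Fin K => μ) = μ :=
      fun k => (measurePreserving_eval (fun _ : Fin K => μ) k).map_eq
    rw [e, e] at hmap
    have hnull : ∀ᵐ p ∂(μ.prod μ), N p.1 ≠ N p.2 := by
      rw [ae_iff]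
      simp only [ne_eq, not_not]
      rw [Measure.measure_prod_null (measurableSet_eq_fun (by fun_prop) (by fun_prop))]
      refine ae_of_all _ fun x => ?_
      have := hμ (N x)
      simpa [Set.preimage, eq_comm] using this
    rw [← hmap] at hnull
    exact ae_of_ae_map (f := fun h : Fin K → E => (h i, h j))
      ((measurable_pi_apply i).prodMk (measurable_pi_apply j)).aemeasurable hnull
  have hall := ae_all_iff.2 fun i => ae_all_iff.2 fun j => ae_all_iff.2 fun hij => key i j hij
  filter_upwards [hall] with h hh i j hij
  by_contra hne
  exact hh i j hne hij

lemma lintegral_pi_succAbove (i : Fin (n + 1)) {F : E → (Fin n → E) → ℝ≥0∞}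
    (hF : Measurable (Function.uncurry F)) :
    ∫⁻ h, F (h i) (fun l => h (i.succAbove l)) ∂(Measure.pi fun _ => μ) =
      ∫⁻ x, ∫⁻ h, F x h ∂(Measure.pi fun _ => μ) ∂μ := by
  have h1 := (measurePreserving_piFinSuccAbove (fun _ : Fin (n + 1) => μ) i).lintegral_comp hF
  rw [lintegral_prod _ hF.aemeasurable] at h1
  exact h1

lemma measurable_measure_lt (hN : Measurable N) : Measurable fun x => μ {z | N z < N x} :=
  measurable_measure_prodMk_left (ν := μ) (s := {p : E × E | N p.2 < N p.1})
    (measurableSet_lt (hN.comp measurable_snd) (hN.comp measurable_fst))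

lemma measurableSet_forall_lt (hN : Measurable N) :
    MeasurableSet {p : E × (Fin n → E) | ∀ l, N (p.2 l) < N p.1} :=
  measurableSet_setOfPred.2 (.forall fun l => measurableSet_setOfPred.1 (measurableSet_lt
    (hN.comp ((measurable_pi_apply l).comp measurable_snd)) (hN.comp measurable_fst)))

lemma measure_pi_forall_lt (r : ℝ) :
    (Measure.pi fun _ : Fin n => μ) {h | ∀ l, N (h l) < r} = μ {z | N z < r} ^ n := by
  have : {h : Fin n → E | ∀ l, N (h l) < r} = Set.univ.pi fun _ => {z | N z < r} := by
    ext; simp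
  rw [this, Measure.pi_pi]
  simp

/-- Integral over the event that member `i` exceeds all the others. -/
lemma lintegral_pi_indicator_max (hN : Measurable N) (i : Fin (n + 1)) {f : E → ℝ≥0∞}
    (hf : Measurable f) :
    ∫⁻ h, {h : Fin (n + 1) → E | ∀ l, N (h (i.succAbove l)) < N (h i)}.indicator
        (fun h => f (h i)) h ∂(Measure.pi fun _ => μ) =
      ∫⁻ x, f x * μ {z | N z < N x} ^ n ∂μ := by
  have hm : Measurable (Function.uncurry fun (x : E) (h : Fin n → E) =>
      {h | ∀ l, N (h l) < N x}.indicator (fun _ => f x) h) :=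
    (hf.comp measurable_fst).indicator (measurableSet_forall_lt hN)
  have := lintegral_pi_succAbove μ i hm
  refine this.trans (lintegral_congr fun x => ?_)
  have hs : MeasurableSet {h : Fin n → E | ∀ l, N (h l) < N x} :=
    (measurableSet_forall_lt hN).preimage (measurable_prodMk_left (x := x))
  rw [lintegral_indicator_const hs, measure_pi_forall_lt]

lemma measurable_indicator_two_max (hN : Measurable N) (j : Fin (n + 1)) {f : E → E → ℝ≥0∞}
    (hf : Measurable (Function.uncurry f)) :
    Measurable (Function.uncurry fun (x : E) (h : Fin (n + 1) → E) =>
      {h | N (h j) < N x ∧ ∀ l, N (h (j.succAbove l)) < N (h j)}.indicator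
        (fun h => f x (h j)) h) := by
  have hj : Measurable fun p : E × (Fin (n + 1) → E) => p.2 j :=
    (measurable_pi_apply j).comp measurable_snd
  refine Measurable.indicator (s := {p : E × (Fin (n + 1) → E) |
      N (p.2 j) < N p.1 ∧ ∀ l, N (p.2 (j.succAbove l)) < N (p.2 j)}) (f := fun p => f p.1 (p.2 j))
    (hf.comp (measurable_fst.prodMk hj)) ?_
  exact measurableSet_setOfPred.2 (.and
    (measurableSet_setOfPred.1 (measurableSet_lt (hN.comp hj) (hN.comp measurable_fst)))
    (.forall fun l => measurableSet_setOfPred.1 (measurableSet_lt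
      (hN.comp ((measurable_pi_apply _).comp measurable_snd)) (hN.comp hj))))

/-- Integral over the event that members `i` and `i.succAbove j` are the two largest ones. -/
lemma lintegral_pi_indicator_two_max (hN : Measurable N) (i : Fin (n + 2)) (j : Fin (n + 1))
    {f : E → E → ℝ≥0∞} (hf : Measurable (Function.uncurry f)) :
    ∫⁻ h, {h : Fin (n + 2) → E | N (h (i.succAbove j)) < N (h i) ∧
        ∀ l, N (h (i.succAbove (j.succAbove l))) < N (h (i.succAbove j))}.indicator
        (fun h => f (h i) (h (i.succAbove j))) h ∂(Measure.pi fun _ => μ) =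
      ∫⁻ y, (∫⁻ x, {x | N y < N x}.indicator (fun x => f x y) x ∂μ) * μ {z | N z < N y} ^ n ∂μ := by
  have hm2 : Measurable (Function.uncurry fun x y : E =>
      {x | N y < N x}.indicator (fun x => f x y) x) :=
    Measurable.indicator (s := {p : E × E | N p.2 < N p.1})
      hf (measurableSet_lt (hN.comp measurable_snd) (hN.comp measurable_fst))
  have hm3 : Measurable (Function.uncurry fun x y : E =>
      {x | N y < N x}.indicator (fun x => f x y) x * μ {z | N z < N y} ^ n) :=
    hm2.mul (((measurable_measure_lt μ hN).comp measurable_snd).pow_const n)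
  refine (lintegral_pi_succAbove μ i (measurable_indicator_two_max hN j hf)).trans ?_
  have inner_eq : ∀ x, ∫⁻ h : Fin (n + 1) → E,
      {h | N (h j) < N x ∧ ∀ l, N (h (j.succAbove l)) < N (h j)}.indicator (fun h => f x (h j)) h
        ∂(Measure.pi fun _ => μ) =
      ∫⁻ y, {x | N y < N x}.indicator (fun x => f x y) x * μ {z | N z < N y} ^ n ∂μ := by
    intro x
    rw [← lintegral_pi_indicator_max μ hN j
      (f := fun y => {x | N y < N x}.indicator (fun x => f x y) x)
      (hm2.comp (measurable_prodMk_left (x := x)))]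
    refine lintegral_congr fun h => ?_
    by_cases h1 : N (h j) < N x <;> by_cases h2 : ∀ l, N (h (j.succAbove l)) < N (h j) <;>
      simp [Set.indicator, h1, h2]
  simp_rw [inner_eq]
  rw [lintegral_lintegral_swap hm3.aemeasurable]
  refine lintegral_congr fun y => ?_
  rw [lintegral_mul_const]
  exact hm2.comp (measurable_prodMk_right (y := y))

/-- Law of the member with the largest value of `N`. -/
lemma lintegral_pi_sort_zero (hN : Measurable N) (hμ : ∀ r : ℝ, μ {x | N x = r} = 0)
    {f : E → ℝ≥0∞} (hf : Measurable f) :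
    ∫⁻ h : Fin (n + 2) → E, f (h (Tuple.sort (fun k => -N (h k)) 0)) ∂(Measure.pi fun _ => μ) =
      (n + 2) * ∫⁻ x, f x * μ {z | N z < N x} ^ (n + 1) ∂μ := by
  have hae : ∀ᵐ h ∂(Measure.pi fun _ : Fin (n + 2) => μ),
      f (h (Tuple.sort (fun k => -N (h k)) 0)) =
      ∑ i, {h : Fin (n + 2) → E | ∀ l, N (h (i.succAbove l)) < N (h i)}.indicator
        (fun h => f (h i)) h := by
    filter_upwards [ae_pi_injective_comp μ hN hμ (n + 2)] with h hh
    simp only [Set.indicator, Set.mem_ofPred_eq, ← sort_neg_zero_eq_iff hh, Finset.sum_ite_eq,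
      Finset.mem_univ, if_true]
  rw [lintegral_congr_ae hae, lintegral_finsetSum]
  · simp_rw [lintegral_pi_indicator_max μ hN _ hf]
    simp
  · intro i _
    exact (Measurable.indicator (hf.comp measurable_fst) (measurableSet_forall_lt hN)).comp
      ((measurable_pi_apply i).prodMk (measurable_pi_lambda
        (fun (h : Fin (n + 2) → E) l => h (i.succAbove l)) fun l => measurable_pi_apply _))

/-- Joint law of the two members with the largest values of `N`. -/
lemma lintegral_pi_sort_zero_one (hN : Measurable N) (hμ : ∀ r : ℝ, μ {x | N x = r} = 0)
    {f : E → E → ℝ≥0∞} (hf : Measurable (Function.uncurry f)) :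
    ∫⁻ h : Fin (n + 2) → E, f (h (Tuple.sort (fun k => -N (h k)) 0))
        (h (Tuple.sort (fun k => -N (h k)) 1)) ∂(Measure.pi fun _ => μ) =
      (n + 2) * (n + 1) * ∫⁻ y, (∫⁻ x, {x | N y < N x}.indicator (fun x => f x y) x ∂μ) *
        μ {z | N z < N y} ^ n ∂μ := by
  have hae : ∀ᵐ h ∂(Measure.pi fun _ : Fin (n + 2) => μ),
      f (h (Tuple.sort (fun k => -N (h k)) 0)) (h (Tuple.sort (fun k => -N (h k)) 1)) =
      ∑ i, ∑ j, {h : Fin (n + 2) → E | N (h (i.succAbove j)) < N (h i) ∧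
        ∀ l, N (h (i.succAbove (j.succAbove l))) < N (h (i.succAbove j))}.indicator
        (fun h => f (h i) (h (i.succAbove j))) h := by
    filter_upwards [ae_pi_injective_comp μ hN hμ (n + 2)] with h hh
    simp only [Set.indicator, Set.mem_ofPred_eq, ← sort_neg_zero_one_eq_iff hh]
    set τ := Tuple.sort fun k => -N (h k) with hτ
    have hne : τ 1 ≠ τ 0 := fun he => absurd (τ.injective he) (by simp)
    obtain ⟨j, hj⟩ := Fin.exists_succAbove_eq hne
    rw [Finset.sum_eq_single (τ 0), Finset.sum_eq_single j]
    · rw [if_pos ⟨rfl, hj.symm⟩, hj]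
    · intro j' _ hj'
      rw [if_neg]
      rintro ⟨-, h1⟩
      exact hj' (Fin.succAbove_right_injective (h1.symm.trans hj.symm))
    · simp
    · intro i _ hi
      refine Finset.sum_eq_zero fun j' _ => ?_
      rw [if_neg]
      rintro ⟨h0, -⟩
      exact hi h0.symm
    · simp
  have hmeas : ∀ (i : Fin (n + 2)) (j : Fin (n + 1)), Measurable fun h : Fin (n + 2) → E =>
      {h : Fin (n + 2) → E | N (h (i.succAbove j)) < N (h i) ∧
        ∀ l, N (h (i.succAbove (j.succAbove l))) < N (h (i.succAbove j))}.indicator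
        (fun h => f (h i) (h (i.succAbove j))) h := fun i j =>
    (measurable_indicator_two_max hN j hf).comp
      ((measurable_pi_apply i).prodMk (measurable_pi_lambda
        (fun (h : Fin (n + 2) → E) l => h (i.succAbove l)) fun l => measurable_pi_apply _))
  rw [lintegral_congr_ae hae,
    lintegral_finsetSum _ fun i _ => Finset.measurable_sum _ fun j _ => hmeas i j]
  simp_rw [lintegral_finsetSum _ fun j _ => hmeas _ j, lintegral_pi_indicator_two_max μ hN _ _ hf]
  simp [mul_assoc]

end OrderStatistics

/-! ### The exact minimum transmit power of two users -/

lemma norm_sub_inner_smul_sq {E : Type*} [NormedAddCommGroup E] [InnerProductSpace ℂ E]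
    {u : E} (hu : ‖u‖ = 1) (a : E) (c : ℝ) :
    ‖a - (c * inner ℂ u a) • u‖ ^ 2 = ‖a‖ ^ 2 - (2 * c - c ^ 2) * ‖inner ℂ u a‖ ^ 2 := by
  have h1 : RCLike.re (inner ℂ a ((c * inner ℂ u a) • u)) = c * ‖inner ℂ u a‖ ^ 2 := by
    rw [inner_smul_right, mul_assoc, ← inner_conj_symm a u, Complex.mul_conj,
      ← Complex.normSq_eq_norm_sq]
    simp [← Complex.ofReal_mul]
  rw [@norm_sub_sq ℂ, h1, norm_smul, hu, norm_mul]
  simp [mul_pow]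
  ring

/-- Cauchy-Schwarz inequality for the inner product with Gram operator `1 + γ u u†`. -/
lemma norm_inner_sq_le_mul {E : Type*} [NormedAddCommGroup E] [InnerProductSpace ℂ E]
    {u : E} (hu : ‖u‖ = 1) (a v : E) {γ : ℝ} (hγ : 0 < γ) :
    ‖inner ℂ a v‖ ^ 2 ≤
      (‖a‖ ^ 2 - γ / (1 + γ) * ‖inner ℂ u a‖ ^ 2) * (‖v‖ ^ 2 + γ * ‖inner ℂ u v‖ ^ 2) := by
  -- split both vectors into their components along `u` and orthogonal to `u`
  have hsub : ∀ w : E, ‖w - inner ℂ u w • u‖ ^ 2 = ‖w‖ ^ 2 - ‖inner ℂ u w‖ ^ 2 := by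
    intro w
    have := norm_sub_inner_smul_sq hu w 1
    simp only [Complex.ofReal_one, one_mul] at this
    rw [this]; ring
  have hinner : inner ℂ a v = inner ℂ (a - inner ℂ u a • u) (v - inner ℂ u v • u) +
      inner ℂ a u * inner ℂ u v := by
    have huu : inner ℂ u u = 1 := by
      rw [inner_self_eq_norm_sq_to_K, hu]; simp
    simp only [inner_sub_left, inner_sub_right, inner_smul_left, inner_smul_right, huu,
      inner_conj_symm]
    ring
  have hle : ‖inner ℂ a v‖ ≤ ‖a - inner ℂ u a • u‖ * ‖v - inner ℂ u v • u‖ +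
      ‖inner ℂ u a‖ * ‖inner ℂ u v‖ := by
    rw [hinner]
    refine (norm_add_le _ _).trans (add_le_add (norm_inner_le_norm _ _) ?_)
    rw [norm_mul, norm_inner_symm]
  have ha := hsub a
  have hv := hsub v
  set p := ‖a - inner ℂ u a • u‖
  set q := ‖v - inner ℂ u v • u‖
  set α := ‖inner ℂ u a‖
  set β := ‖inner ℂ u v‖
  have e1 : ‖a‖ ^ 2 - γ / (1 + γ) * α ^ 2 = p ^ 2 + α ^ 2 / (1 + γ) := by
    rw [ha]; field_simp; ring
  have e2 : ‖v‖ ^ 2 + γ * β ^ 2 = q ^ 2 + (1 + γ) * β ^ 2 := by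
    rw [hv]; ring
  rw [e1, e2]
  refine (pow_le_pow_left₀ (norm_nonneg _) hle 2).trans ?_
  have : (p ^ 2 + α ^ 2 / (1 + γ)) * (q ^ 2 + (1 + γ) * β ^ 2) - (p * q + α * β) ^ 2 =
      (p * (1 + γ) * β - α * q) ^ 2 / (1 + γ) := by
    field_simp; ring
  have h2 : 0 ≤ (p * (1 + γ) * β - α * q) ^ 2 / (1 + γ) := by positivity
  linarith

section TwoUsers

variable {M : ℕ}

/-- The least total power serving the channels `a` and `b` with SINR target `γ` when the user with
channel `a` is encoded so as to be free of interference, and `b` suffers from the stream of `a`. -/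
def pairPower (noise γ : ℝ) (a b : EuclideanSpace ℂ (Fin M)) : ℝ :=
  γ * noise * (1 / ‖b‖ ^ 2 + 1 / (‖a‖ ^ 2 * (1 - γ / (1 + γ) * cosSq a b)))

lemma one_sub_mul_cosSq_pos {γ : ℝ} (hγ : 0 < γ) (a b : EuclideanSpace ℂ (Fin M)) :
    0 < 1 - γ / (1 + γ) * cosSq a b := by
  have h1 : γ / (1 + γ) < 1 := by rw [div_lt_one (by linarith)]; linarith
  have h2 : 0 ≤ γ / (1 + γ) := by positivity
  have := mul_le_of_le_one_right h2 (cosSq_le_one a b)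
  linarith

lemma norm_sq_mul_one_sub {γ : ℝ} {a b : EuclideanSpace ℂ (Fin M)} (ha : a ≠ 0) (hb : b ≠ 0) :
    ‖a‖ ^ 2 * (1 - γ / (1 + γ) * cosSq a b) =
      ‖a‖ ^ 2 - γ / (1 + γ) * ‖inner ℂ ((‖b‖ : ℂ)⁻¹ • b) a‖ ^ 2 := by
  have ha' : ‖a‖ ≠ 0 := norm_ne_zero_iff.2 ha
  have hb' : ‖b‖ ≠ 0 := norm_ne_zero_iff.2 hb
  rw [inner_smul_left, norm_mul, cosSq]
  simp only [map_inv₀, Complex.conj_ofReal, norm_inv, Complex.norm_real, norm_norm]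
  field_simp

lemma norm_inv_norm_smul {b : EuclideanSpace ℂ (Fin M)} (hb : b ≠ 0) :
    ‖(‖b‖ : ℂ)⁻¹ • b‖ = 1 := by
  have hb' : ‖b‖ ≠ 0 := norm_ne_zero_iff.2 hb
  simp [norm_smul, hb']

/-- Serving the stronger user free of interference is the better one of the two orders. -/
lemma pairPower_le_swap {noise γ : ℝ} (hn : 0 < noise) (hγ : 0 < γ)
    {a b : EuclideanSpace ℂ (Fin M)} (hb : b ≠ 0) (hab : ‖b‖ ≤ ‖a‖) :
    pairPower noise γ a b ≤ pairPower noise γ b a := by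
  have hb' : 0 < ‖b‖ := norm_pos_iff.2 hb
  have ht := one_sub_mul_cosSq_pos hγ a b
  have ht1 : 1 - γ / (1 + γ) * cosSq a b ≤ 1 := by
    have := cosSq_nonneg a b
    have : 0 ≤ γ / (1 + γ) * cosSq a b := by positivity
    linarith
  unfold pairPower
  rw [cosSq_comm b a]
  set t := 1 - γ / (1 + γ) * cosSq a b
  have hX : 1 / ‖a‖ ^ 2 ≤ 1 / ‖b‖ ^ 2 :=
    one_div_le_one_div_of_le (by positivity) (pow_le_pow_left₀ hb'.le hab 2)
  have hT : 1 ≤ 1 / t := by rw [le_div_iff₀ ht]; linarith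
  refine mul_le_mul_of_nonneg_left ?_ (by positivity)
  rw [← one_div_mul_one_div, ← one_div_mul_one_div]
  nlinarith [mul_nonneg (sub_nonneg.2 hX) (sub_nonneg.2 hT)]

lemma pairPower_le_of_sinr {noise γ : ℝ} (hn : 0 < noise) (hγ : 0 < γ)
    {a b : EuclideanSpace ℂ (Fin M)} (ha : a ≠ 0) (hb : b ≠ 0)
    {va vb : EuclideanSpace ℂ (Fin M)} (hva : ‖va‖ = 1) (hvb : ‖vb‖ = 1) {pa pb : ℝ}
    (hpa : 0 < pa) (hpb : 0 < pb) (h1 : γ ≤ pa * ‖inner ℂ a va‖ ^ 2 / noise)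
    (h2 : γ ≤ pb * ‖inner ℂ b vb‖ ^ 2 / (pa * ‖inner ℂ b va‖ ^ 2 + noise)) :
    pairPower noise γ a b ≤ pa + pb := by
  have ha' : 0 < ‖a‖ := norm_pos_iff.2 ha
  have hb' : 0 < ‖b‖ := norm_pos_iff.2 hb
  rw [le_div_iff₀ hn] at h1
  rw [le_div_iff₀ (by positivity)] at h2
  -- `pa` and the power `b` needs against its interference cost at least `γ * noise / D` together
  have hcs := norm_inner_sq_le_mul (norm_inv_norm_smul hb) a va hγ
  have hD : 0 < ‖a‖ ^ 2 * (1 - γ / (1 + γ) * cosSq a b) :=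
    mul_pos (by positivity) (one_sub_mul_cosSq_pos hγ a b)
  rw [← norm_sq_mul_one_sub ha hb, hva, inner_smul_left, norm_mul] at hcs
  simp only [map_inv₀, Complex.conj_ofReal, norm_inv, Complex.norm_real, norm_norm, mul_pow,
    inv_pow, one_pow] at hcs
  unfold pairPower
  set D := ‖a‖ ^ 2 * (1 - γ / (1 + γ) * cosSq a b)
  have hvb2 : ‖inner ℂ b vb‖ ^ 2 ≤ ‖b‖ ^ 2 := by
    have := norm_inner_le_norm (𝕜 := ℂ) b vb
    rw [hvb, mul_one] at this
    exact pow_le_pow_left₀ (norm_nonneg _) this 2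
  have h3 : γ * (pa * ‖inner ℂ b va‖ ^ 2 + noise) / ‖b‖ ^ 2 ≤ pb := by
    rw [div_le_iff₀ (by positivity)]
    exact h2.trans (mul_le_mul_of_nonneg_left hvb2 hpb.le)
  have h4 : γ * noise / D ≤ pa * (1 + γ * ((‖b‖ ^ 2)⁻¹ * ‖inner ℂ b va‖ ^ 2)) := by
    rw [div_le_iff₀ hD]
    have := mul_le_mul_of_nonneg_left hcs hpa.le
    nlinarith
  have e : γ * noise * (1 / ‖b‖ ^ 2 + 1 / D) + pa * (1 + γ * ((‖b‖ ^ 2)⁻¹ * ‖inner ℂ b va‖ ^ 2)) =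
      pa + γ * (pa * ‖inner ℂ b va‖ ^ 2 + noise) / ‖b‖ ^ 2 + γ * noise / D := by
    field_simp
    ring
  linarith

/-- The optimal beamforming vector of `a` is the normalization of `a - γ / (1 + γ) ⟨u, a⟩ u` with
`u = b / ‖b‖`, which gives equality in the Cauchy-Schwarz inequality, and that of `b` is `u`. -/
lemma exists_sinr_eq_pairPower {noise γ : ℝ} (hn : 0 < noise) (hγ : 0 < γ)
    {a b : EuclideanSpace ℂ (Fin M)} (ha : a ≠ 0) (hb : b ≠ 0) :
    ∃ (va vb : EuclideanSpace ℂ (Fin M)) (pa pb : ℝ), ‖va‖ = 1 ∧ ‖vb‖ = 1 ∧ 0 < pa ∧ 0 < pb ∧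
      γ ≤ pa * ‖inner ℂ a va‖ ^ 2 / noise ∧
      γ ≤ pb * ‖inner ℂ b vb‖ ^ 2 / (pa * ‖inner ℂ b va‖ ^ 2 + noise) ∧
      pairPower noise γ a b = pa + pb := by
  have ha' : 0 < ‖a‖ := norm_pos_iff.2 ha
  have hb' : 0 < ‖b‖ := norm_pos_iff.2 hb
  have hD : 0 < ‖a‖ ^ 2 * (1 - γ / (1 + γ) * cosSq a b) :=
    mul_pos (by positivity) (one_sub_mul_cosSq_pos hγ a b)
  unfold pairPower
  rw [norm_sq_mul_one_sub ha hb] at hD ⊢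
  have hu := norm_inv_norm_smul hb
  have hbu : b = (‖b‖ : ℂ) • ((‖b‖ : ℂ)⁻¹ • b) := by
    rw [smul_smul, mul_inv_cancel₀ (by exact_mod_cast hb'.ne'), one_smul]
  set u := (‖b‖ : ℂ)⁻¹ • b
  have hbin : ∀ x, ‖inner ℂ b x‖ ^ 2 = ‖b‖ ^ 2 * ‖inner ℂ u x‖ ^ 2 := by
    intro x
    conv_lhs => rw [hbu]
    rw [inner_smul_left, norm_mul, mul_pow]
    simp
  set κ := γ / (1 + γ) with hκ
  set α := ‖inner ℂ u a‖ with hα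
  set D := ‖a‖ ^ 2 - κ * α ^ 2 with hDdef
  set w := a - (κ * inner ℂ u a) • u with hw
  have hwn : ‖w‖ ^ 2 = ‖a‖ ^ 2 - (2 * κ - κ ^ 2) * α ^ 2 := norm_sub_inner_smul_sq hu a κ
  have huu : inner ℂ u u = (1 : ℂ) := by
    rw [inner_self_eq_norm_sq_to_K, hu]; simp
  have haw : inner ℂ a w = (D : ℂ) := by
    rw [hw, inner_sub_right, inner_smul_right, mul_assoc, ← inner_conj_symm a u, Complex.mul_conj,
      Complex.normSq_eq_norm_sq, inner_self_eq_norm_sq_to_K, hDdef, hα]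
    simp
  have huw : inner ℂ u w = ((1 - κ : ℝ) : ℂ) * inner ℂ u a := by
    rw [hw, inner_sub_right, inner_smul_right, huu]
    push_cast
    ring
  have hwpos : 0 < ‖w‖ := by
    rw [norm_pos_iff]
    intro h0
    rw [h0, inner_zero_right] at haw
    exact hD.ne (by exact_mod_cast haw)
  have hnorm : ‖(‖w‖ : ℂ)⁻¹ • w‖ = 1 := norm_inv_norm_smul (norm_pos_iff.1 hwpos)
  have hva : ‖inner ℂ a ((‖w‖ : ℂ)⁻¹ • w)‖ ^ 2 = D ^ 2 / ‖w‖ ^ 2 := by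
    rw [inner_smul_right, haw, norm_mul, mul_pow]
    simp
    field_simp
  have hvu : ‖inner ℂ u ((‖w‖ : ℂ)⁻¹ • w)‖ ^ 2 = (1 - κ) ^ 2 * α ^ 2 / ‖w‖ ^ 2 := by
    rw [inner_smul_right, huw, norm_mul, norm_mul, mul_pow, mul_pow, Complex.norm_real,
      Real.norm_eq_abs, sq_abs]
    simp
    field_simp
    rw [hα]
  have key : ‖w‖ ^ 2 + γ * ((1 - κ) ^ 2 * α ^ 2) = D := by
    rw [hwn, hDdef, hκ]
    field_simp
    ring
  refine ⟨(‖w‖ : ℂ)⁻¹ • w, u, γ * noise * ‖w‖ ^ 2 / D ^ 2,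
    γ * (γ * noise / D ^ 2 * ((1 - κ) ^ 2 * α ^ 2) + noise / ‖b‖ ^ 2), hnorm, hu,
    by positivity, by positivity, ?_, ?_, ?_⟩
  · rw [hva]
    apply le_of_eq
    field_simp
  · rw [hbin, hbin, huu, hvu]
    apply le_of_eq
    simp only [norm_one, one_pow, mul_one]
    rw [eq_div_iff (by positivity)]
    field_simp
  · rw [show γ * noise * (1 / ‖b‖ ^ 2 + 1 / D) =
      γ * noise * (‖w‖ ^ 2 + γ * ((1 - κ) ^ 2 * α ^ 2)) / D ^ 2 + γ * noise / ‖b‖ ^ 2 by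
      rw [key]; field_simp; ring]
    ring

lemma minTransmitPower_eq_pairPower {noise γ : ℝ} (hn : 0 < noise) (hγ : 0 < γ)
    {g : Fin 2 → EuclideanSpace ℂ (Fin M)} (h1 : g 1 ≠ 0) (hle : ‖g 1‖ ≤ ‖g 0‖) :
    minTransmitPower noise γ g = pairPower noise γ (g 0) (g 1) := by
  have h0 : g 0 ≠ 0 := norm_pos_iff.1 ((norm_pos_iff.2 h1).trans_le hle)
  refine IsLeast.csInf_eq ⟨?_, ?_⟩
  · obtain ⟨va, vb, pa, pb, hva, hvb, hpa, hpb, hsa, hsb, he⟩ :=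
      exists_sinr_eq_pairPower hn hγ h0 h1
    refine ⟨1, ![va, vb], ![pa, pb], ?_, ?_, ?_, ?_⟩
    · simp [Fin.forall_fin_two, hva, hvb]
    · simp [Fin.forall_fin_two, hpa, hpb]
    · simp [Fin.forall_fin_two, sinr, Finset.sum_filter, hsa, hsb]
    · simp [he]
  · rintro T ⟨π, v, p, hv, hp, hs, rfl⟩
    rw [Fin.sum_univ_two]
    have hs0 := hs 0
    have hs1 := hs 1
    simp only [sinr, Finset.sum_filter, Fin.sum_univ_two, lt_self_iff_false, if_false, zero_add,
      add_zero] at hs0 hs1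
    rcases lt_or_gt_of_ne (fun h => absurd (π.injective h) (by simp) : π 0 ≠ π 1) with h | h
    · rw [if_neg h.asymm, zero_add] at hs0
      rw [if_pos h] at hs1
      exact pairPower_le_of_sinr hn hγ h0 h1 (hv 0) (hv 1) (hp 0) (hp 1) hs0 hs1
    · rw [if_neg h.asymm, zero_add] at hs1
      rw [if_pos h] at hs0
      rw [add_comm]
      exact (pairPower_le_swap hn hγ h1 hle).trans
        (pairPower_le_of_sinr hn hγ h1 h0 (hv 1) (hv 0) (hp 1) (hp 0) hs1 hs0)

lemma largeSINRPower_rev (noise γ : ℝ) (g : Fin 2 → EuclideanSpace ℂ (Fin M)) :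
    largeSINRPower noise γ (g ∘ Fin.rev) =
      noise * γ * (1 / ‖g 1‖ ^ 2 + 1 / ‖g 0‖ ^ 2 * (1 / (1 - cosSq (g 0) (g 1)))) := by
  have e0 : interferenceSubspace (g ∘ Fin.rev) 0 = ⊥ := by
    simp [interferenceSubspace]
  have e1 : interferenceSubspace (g ∘ Fin.rev) 1 = Submodule.span ℂ {g 1} := by
    have : {j : Fin 2 | j < 1} = {0} := by
      ext j; fin_cases j <;> simp
    rw [interferenceSubspace, this]
    simp
  have hb : Real.sin (angleToSubspace (g 1) ⊥) ^ 2 = 1 := by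
    simp [angleToSubspace]
  rw [largeSINRPower, Fin.sum_univ_two, e0, e1]
  simp only [Function.comp_apply, show Fin.rev (0 : Fin 2) = 1 from rfl,
    show Fin.rev (1 : Fin 2) = 0 from rfl]
  rw [sin_angleToSubspace_span_singleton_sq, hb]
  simp only [div_eq_mul_inv, mul_inv]
  ring

end TwoUsers

/-! ### Order statistics of the squared channel norms -/

lemma integrableOn_exp_neg_mul_pow (k : ℕ) :
    IntegrableOn (fun x : ℝ => Real.exp (-x) * x ^ k) (Set.Ioi 0) := by
  refine (Real.GammaIntegral_convergent (s := k + 1) (by positivity)).congr_fun (fun x _ => ?_)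
    measurableSet_Ioi
  simp

lemma regGamma_nonneg (M : ℕ) {x : ℝ} (hx : 0 ≤ x) : 0 ≤ regGamma M x := by
  refine mul_nonneg (by positivity) (intervalIntegral.integral_nonneg hx ?_)
  intro u hu
  have := hu.1
  positivity

lemma gaussianVector_norm_lt (n : ℕ) {r : ℝ} (hr : 0 ≤ r) :
    gaussianVector (n + 1) {x | ‖x‖ < r} = ENNReal.ofReal (regGamma (n + 1) (r ^ 2)) := by
  have h := lintegral_gaussianVector_normSq n
    (φ := Set.indicator (Set.Iio (r ^ 2)) 1) (measurable_one.indicator measurableSet_Iio)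
  have h1 : ∫⁻ x, Set.indicator (Set.Iio (r ^ 2)) 1 (‖x‖ ^ 2) ∂(gaussianVector (n + 1)) =
      gaussianVector (n + 1) {x | ‖x‖ < r} := by
    rw [← lintegral_indicator_one (measurableSet_lt (by fun_prop) (by fun_prop))]
    refine lintegral_congr fun x => ?_
    simp [Set.indicator, pow_lt_pow_iff_left₀ (norm_nonneg x) hr]
  rw [← h1, h]
  have h2 : ∀ s : ℝ, ENNReal.ofReal (Real.exp (-s) * s ^ n / n.factorial) *
      Set.indicator (Set.Iio (r ^ 2)) 1 s = Set.indicator (Set.Iio (r ^ 2))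
        (fun s => ENNReal.ofReal (Real.exp (-s) * s ^ n / n.factorial)) s := by
    intro s
    by_cases hs : s ∈ Set.Iio (r ^ 2) <;> simp [hs]
  simp_rw [h2]
  rw [setLIntegral_indicator measurableSet_Iio, Set.Iio_inter_Ioi,
    ← ofReal_integral_eq_lintegral_ofReal]
  · congr 1
    rw [← integral_Ioc_eq_integral_Ioo, ← intervalIntegral.integral_of_le (by positivity),
      intervalIntegral.integral_div, regGamma, Nat.cast_add_one,
      Real.Gamma_nat_eq_factorial, Nat.add_sub_cancel]
    ring
  · exact ((integrableOn_exp_neg_mul_pow n).mono_set Set.Ioo_subset_Ioi_self).div_const _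
  · filter_upwards [ae_restrict_mem measurableSet_Ioo] with s hs
    have : 0 < s := hs.1
    simp only [Pi.zero_apply]
    positivity

lemma gaussianVector_lt_norm (n : ℕ) {r : ℝ} (hr : 0 ≤ r) :
    gaussianVector (n + 1) {x | r < ‖x‖} = ENNReal.ofReal (1 - regGamma (n + 1) (r ^ 2)) := by
  have hc : {x : EuclideanSpace ℂ (Fin (n + 1)) | r < ‖x‖} = {x | ‖x‖ ≤ r}ᶜ := by ext; simp
  have hle : gaussianVector (n + 1) {x | ‖x‖ ≤ r} = gaussianVector (n + 1) {x | ‖x‖ < r} := by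
    refine le_antisymm ?_ (measure_mono fun x (hx : ‖x‖ < r) => hx.le)
    have : {x : EuclideanSpace ℂ (Fin (n + 1)) | ‖x‖ ≤ r} ⊆ {x | ‖x‖ < r} ∪ {x | ‖x‖ = r} :=
      fun x (hx : ‖x‖ ≤ r) => lt_or_eq_of_le hx
    refine (measure_mono this).trans ((measure_union_le _ _).trans ?_)
    rw [gaussianVector_norm_eq, add_zero]
  rw [hc, prob_compl_eq_one_sub (measurableSet_le (by fun_prop) (by fun_prop)), hle,
    gaussianVector_norm_lt n hr, ENNReal.ofReal_sub _ (regGamma_nonneg (n + 1) (sq_nonneg r)),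
    ENNReal.ofReal_one]

lemma regGamma_le_one (n : ℕ) {x : ℝ} (hx : 0 ≤ x) : regGamma (n + 1) x ≤ 1 := by
  have h := gaussianVector_norm_lt n (Real.sqrt_nonneg x)
  rw [Real.sq_sqrt hx] at h
  rw [← ENNReal.ofReal_le_one, ← h]
  exact prob_le_one

@[fun_prop]
lemma continuous_regGamma (M : ℕ) : Continuous (regGamma M) := by
  unfold regGamma
  refine continuous_const.mul (intervalIntegral.continuous_primitive (fun a b => ?_) 0)
  exact Continuous.intervalIntegrable (by fun_prop) a b

lemma integrableOn_mul_regGamma_pow (k n j : ℕ) :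
    IntegrableOn (fun x => Real.exp (-x) * x ^ k / n.factorial * regGamma (n + 1) x ^ j)
      (Set.Ioi 0) := by
  have hm : Measurable (regGamma (n + 1)) := (continuous_regGamma (n + 1)).measurable
  refine ((integrableOn_exp_neg_mul_pow k).div_const (n.factorial : ℝ)).mono'
    (Measurable.aestronglyMeasurable (by fun_prop)) ?_
  filter_upwards [ae_restrict_mem measurableSet_Ioi] with x hx
  have hx : 0 < x := hx
  have h0 := regGamma_nonneg (n + 1) hx.le
  rw [Real.norm_of_nonneg (by positivity)]
  exact mul_le_of_le_one_right (by positivity) (pow_le_one₀ h0 (regGamma_le_one n hx.le))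

lemma alpha_eq (m j : ℕ) :
    alpha (m + 2) (j + 1) = (j + 1) *
      ∫ x in Set.Ioi (0 : ℝ), Real.exp (-x) * x ^ m / (m + 1).factorial *
        regGamma (m + 2) x ^ j := by
  rw [alpha, ← integral_const_mul]
  congr 1
  ext x
  have : ((m + 2 : ℕ) : ℝ) = ((m + 1 : ℕ) : ℝ) + 1 := by push_cast; ring
  rw [this, Real.Gamma_nat_eq_factorial]
  simp only [Nat.add_sub_cancel]
  push_cast
  ring

lemma alpha_nonneg (m j : ℕ) : 0 ≤ alpha (m + 2) (j + 1) := by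
  rw [alpha_eq]
  refine mul_nonneg (by positivity) (setIntegral_nonneg measurableSet_Ioi fun x hx => ?_)
  have hx : 0 < x := hx
  have := regGamma_nonneg (m + 2) hx.le
  positivity

/-- `𝔼[1 / ‖h₍₁₎‖²] = α_{M,K}`. -/
lemma lintegral_inv_normSq_strongest (m n : ℕ) (hK : 2 ≤ n + 2) :
    ∫⁻ h, ENNReal.ofReal (1 / ‖normBasedSelection hK h 0‖ ^ 2)
        ∂(Measure.pi fun _ => gaussianVector (m + 2)) =
      ENNReal.ofReal (alpha (m + 2) (n + 2)) := by
  have h := lintegral_pi_sort_zero (n := n) (gaussianVector (m + 2)) measurable_norm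
    (gaussianVector_norm_eq (m + 1)) (f := fun x => ENNReal.ofReal (1 / ‖x‖ ^ 2)) (by fun_prop)
  refine h.trans ?_
  simp_rw [fun x : EuclideanSpace ℂ (Fin (m + 2)) => gaussianVector_norm_lt (m + 1) (norm_nonneg x)]
  have hm : Measurable (regGamma (m + 2)) := (continuous_regGamma (m + 2)).measurable
  rw [lintegral_gaussianVector_normSq (m + 1)
    (φ := fun s => ENNReal.ofReal (1 / s) * ENNReal.ofReal (regGamma (m + 2) s) ^ (n + 1))
    (by fun_prop), alpha_eq m (n + 1), ENNReal.ofReal_mul (by positivity),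
    ofReal_integral_eq_lintegral_ofReal (integrableOn_mul_regGamma_pow m (m + 1) (n + 1))]
  · congr 1
    · rw [show ((n + 1 : ℕ) : ℝ) + 1 = ((n + 2 : ℕ) : ℝ) by push_cast; ring, ENNReal.ofReal_natCast]
      push_cast
      rfl
    · refine setLIntegral_congr_fun measurableSet_Ioi fun s hs => ?_
      have hs : 0 < s := hs
      have := regGamma_nonneg (m + 2) hs.le
      rw [← ENNReal.ofReal_pow this, ← ENNReal.ofReal_mul (by positivity),
        ← ENNReal.ofReal_mul (by positivity)]
      congr 1
      field_simp
      ring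
  · filter_upwards [ae_restrict_mem measurableSet_Ioi] with s hs
    have hs : 0 < s := hs
    have := regGamma_nonneg (m + 2) hs.le
    simp only [Pi.zero_apply]
    positivity

/-- For the second largest of `n + 2` variables with distribution function `G` the factor
`G ^ n * (1 - G)` replaces the power of `G` occurring for the largest one; expanding it relates the
integral to the largest of `n + 1` and of `n + 2` variables. -/
lemma integral_regGamma_pow_mul_one_sub (m n : ℕ) :
    ∫ x in Set.Ioi (0 : ℝ), Real.exp (-x) * x ^ m / (m + 1).factorial *
        (regGamma (m + 2) x ^ n * (1 - regGamma (m + 2) x)) =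
      (∫ x in Set.Ioi (0 : ℝ), Real.exp (-x) * x ^ m / (m + 1).factorial * regGamma (m + 2) x ^ n) -
      ∫ x in Set.Ioi (0 : ℝ), Real.exp (-x) * x ^ m / (m + 1).factorial *
        regGamma (m + 2) x ^ (n + 1) := by
  rw [← integral_sub (integrableOn_mul_regGamma_pow m (m + 1) n)
    (integrableOn_mul_regGamma_pow m (m + 1) (n + 1))]
  congr 1
  ext x
  ring

lemma mul_alpha_sub_mul_alpha_eq (m n : ℕ) :
    ((n : ℝ) + 2) * alpha (m + 2) (n + 1) - (n + 1) * alpha (m + 2) (n + 2) = (n + 2) * (n + 1) *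
      ∫ x in Set.Ioi (0 : ℝ), Real.exp (-x) * x ^ m / (m + 1).factorial *
        (regGamma (m + 2) x ^ n * (1 - regGamma (m + 2) x)) := by
  rw [integral_regGamma_pow_mul_one_sub, alpha_eq, alpha_eq m (n + 1)]
  push_cast
  ring

lemma mul_alpha_sub_mul_alpha_nonneg (m n : ℕ) :
    0 ≤ ((n : ℝ) + 2) * alpha (m + 2) (n + 1) - (n + 1) * alpha (m + 2) (n + 2) := by
  rw [mul_alpha_sub_mul_alpha_eq]
  refine mul_nonneg (by positivity) (setIntegral_nonneg measurableSet_Ioi fun x hx => ?_)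
  have hx : 0 < x := hx
  have := regGamma_nonneg (m + 2) hx.le
  have := sub_nonneg.2 (regGamma_le_one (m + 1) hx.le)
  positivity

/-- `𝔼[1 / ‖h₍₂₎‖²] = K α_{M,K-1} - (K - 1) α_{M,K}`. -/
lemma lintegral_inv_normSq_second (m n : ℕ) (hK : 2 ≤ n + 2) :
    ∫⁻ h, ENNReal.ofReal (1 / ‖normBasedSelection hK h 1‖ ^ 2)
        ∂(Measure.pi fun _ => gaussianVector (m + 2)) =
      ENNReal.ofReal (((n : ℝ) + 2) * alpha (m + 2) (n + 1) - (n + 1) * alpha (m + 2) (n + 2)) := by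
  have h := lintegral_pi_sort_zero_one (n := n) (gaussianVector (m + 2)) measurable_norm
    (gaussianVector_norm_eq (m + 1)) (f := fun _ y => ENNReal.ofReal (1 / ‖y‖ ^ 2)) (by fun_prop)
  refine h.trans ?_
  have hm : Measurable (regGamma (m + 2)) := (continuous_regGamma (m + 2)).measurable
  have h1 : ∀ y : EuclideanSpace ℂ (Fin (m + 2)), ∫⁻ x, {x | ‖y‖ < ‖x‖}.indicator
      (fun _ => ENNReal.ofReal (1 / ‖y‖ ^ 2)) x ∂(gaussianVector (m + 2)) =
      ENNReal.ofReal (1 / ‖y‖ ^ 2) * ENNReal.ofReal (1 - regGamma (m + 2) (‖y‖ ^ 2)) := by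
    intro y
    rw [lintegral_indicator_const (measurableSet_lt (by fun_prop) (by fun_prop)),
      gaussianVector_lt_norm (m + 1) (norm_nonneg y)]
  simp_rw [h1, fun x : EuclideanSpace ℂ (Fin (m + 2)) =>
    gaussianVector_norm_lt (m + 1) (norm_nonneg x)]
  have hint : IntegrableOn (fun x => Real.exp (-x) * x ^ m / (m + 1).factorial *
        (regGamma (m + 2) x ^ n * (1 - regGamma (m + 2) x))) (Set.Ioi 0) := by
    refine ((integrableOn_mul_regGamma_pow m (m + 1) n).sub
      (integrableOn_mul_regGamma_pow m (m + 1) (n + 1))).congr_fun (fun x _ => ?_) measurableSet_Ioi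
    simp only [Pi.sub_apply]
    ring
  rw [lintegral_gaussianVector_normSq (m + 1)
    (φ := fun s => ENNReal.ofReal (1 / s) * ENNReal.ofReal (1 - regGamma (m + 2) s) *
      ENNReal.ofReal (regGamma (m + 2) s) ^ n)
    (by fun_prop), mul_alpha_sub_mul_alpha_eq, ENNReal.ofReal_mul (by positivity),
    ofReal_integral_eq_lintegral_ofReal hint]
  · congr 1
    · rw [show ((n : ℝ) + 2) * (n + 1) = (((n + 2) * (n + 1) : ℕ) : ℝ) by push_cast; ring,
        ENNReal.ofReal_natCast]
      push_cast
      rfl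
    · refine setLIntegral_congr_fun measurableSet_Ioi fun s hs => ?_
      have hs : 0 < s := hs
      have := regGamma_nonneg (m + 2) hs.le
      have h2 := sub_nonneg.2 (regGamma_le_one (m + 1) hs.le)
      have h3 : 0 ≤ 1 / s * (1 - regGamma (m + 2) s) := mul_nonneg (by positivity) h2
      rw [← ENNReal.ofReal_pow this, ← ENNReal.ofReal_mul (by positivity),
        ← ENNReal.ofReal_mul h3, ← ENNReal.ofReal_mul (by positivity)]
      congr 1
      field_simp
      ring
  · filter_upwards [ae_restrict_mem measurableSet_Ioi] with s hs
    have hs : 0 < s := hs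
    have := regGamma_nonneg (m + 2) hs.le
    have := sub_nonneg.2 (regGamma_le_one (m + 1) hs.le)
    simp only [Pi.zero_apply]
    positivity

/-- The angle between the two selected channels is independent of the norm of the strongest one,
and `𝔼[1 / sin² θ₁] = (M - 1) / (M - 2)`. -/
lemma lintegral_strongest_div_sinSq (m n : ℕ) (hK : 2 ≤ n + 2) {φ : ℝ → ℝ≥0∞} (hφ : Measurable φ) :
    ∫⁻ h, φ (‖normBasedSelection hK h 0‖ ^ 2) *
        (ENNReal.ofReal (1 - cosSq (normBasedSelection hK h 0) (normBasedSelection hK h 1)))⁻¹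
        ∂(Measure.pi fun _ => gaussianVector (m + 3)) =
      ENNReal.ofReal ((m + 2) / (m + 1)) * ∫⁻ h, φ (‖normBasedSelection hK h 0‖ ^ 2)
        ∂(Measure.pi fun _ => gaussianVector (m + 3)) := by
  have hA := lintegral_pi_sort_zero_one (n := n) (gaussianVector (m + 3)) measurable_norm
    (gaussianVector_norm_eq (m + 2))
    (f := fun x y => φ (‖x‖ ^ 2) * (ENNReal.ofReal (1 - cosSq x y))⁻¹) (by fun_prop)
  have hB := lintegral_pi_sort_zero_one (n := n) (gaussianVector (m + 3)) measurable_norm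
    (gaussianVector_norm_eq (m + 2)) (f := fun x _ => φ (‖x‖ ^ 2)) (by fun_prop)
  refine hA.trans (Eq.trans ?_ (congrArg _ hB.symm))
  rw [mul_left_comm, ← lintegral_const_mul' _ _ ENNReal.ofReal_ne_top]
  congr 1
  have h0 : ∀ᵐ y ∂(gaussianVector (m + 3)), y ≠ 0 := by
    have := gaussianVector_norm_eq (m + 2) 0
    rw [ae_iff]
    simpa using this
  refine lintegral_congr_ae ?_
  filter_upwards [h0] with y hy
  rw [← mul_assoc]
  congr 1
  have hind : Measurable ((Set.Ioi (‖y‖ ^ 2)).indicator φ) := hφ.indicator measurableSet_Ioi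
  -- for a fixed second channel `y` the selection event only restricts `‖x‖`
  have h1 := lintegral_gaussianVector_div_sinSq m hind hy
  have hiff : ∀ x : EuclideanSpace ℂ (Fin (m + 3)), ‖x‖ ^ 2 ∈ Set.Ioi (‖y‖ ^ 2) ↔ ‖y‖ < ‖x‖ :=
    fun x => pow_lt_pow_iff_left₀ (norm_nonneg _) (norm_nonneg _) two_ne_zero
  refine Eq.trans (lintegral_congr fun x => ?_)
    (h1.trans (congrArg _ (lintegral_congr fun x => ?_)))
  · simp only [Set.indicator, Set.mem_ofPred_eq, hiff, ite_mul, zero_mul]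
  · simp only [Set.indicator, Set.mem_ofPred_eq, hiff]

/-! ### The joint law of the channels -/

lemma map_curry_pi {ι κ α : Type*} [Fintype ι] [Fintype κ] [MeasurableSpace α] (μ : Measure α)
    [IsProbabilityMeasure μ] :
    (Measure.pi fun _ : ι × κ => μ).map Function.curry =
      Measure.pi fun _ : ι => Measure.pi fun _ : κ => μ := by
  have hu : Measurable (Function.uncurry : (ι → κ → α) → ι × κ → α) :=
    (MeasurableEquiv.curry ι κ α).symm.measurable
  have hc : Measurable (Function.curry : (ι × κ → α) → ι → κ → α) :=
    (MeasurableEquiv.curry ι κ α).measurable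
  have h : (Measure.pi fun _ : ι × κ => μ) =
      (Measure.pi fun _ : ι => Measure.pi fun _ : κ => μ).map Function.uncurry := by
    refine Measure.pi_eq fun s hs => ?_
    rw [Measure.map_apply hu (.univ_pi hs)]
    have : Function.uncurry ⁻¹' (Set.univ.pi s) =
        Set.univ.pi fun i : ι => Set.univ.pi fun j : κ => s (i, j) := by
      ext f
      simp [Set.mem_pi, Function.uncurry]
    rw [this, Measure.pi_pi]
    simp_rw [Measure.pi_pi]
    rw [Fintype.prod_prod_type]
  rw [h, Measure.map_map hc hu]
  simp [Function.comp_def, Function.curry_uncurry]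

lemma hasLaw_channels {Ω : Type*} [MeasurableSpace Ω] {P : Measure Ω} {M K : ℕ}
    {h : Fin K → Ω → EuclideanSpace ℂ (Fin M)}
    (hlaw : ∀ k m, HasLaw (fun ω => h k ω m) stdComplexGaussian P)
    (hindep : iIndepFun (fun (km : Fin K × Fin M) (ω : Ω) => h km.1 ω km.2) P) :
    HasLaw (fun ω k => h k ω) (Measure.pi fun _ => gaussianVector M) P := by
  have h1 := hindep.hasLaw_pi fun km : Fin K × Fin M => hlaw km.1 km.2
  have hc : Measurable (Function.curry : (Fin K × Fin M → ℂ) → Fin K → Fin M → ℂ) :=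
    (MeasurableEquiv.curry _ _ _).measurable
  have h2 : HasLaw Function.curry
      (Measure.pi fun _ : Fin K => Measure.pi fun _ : Fin M => stdComplexGaussian)
      (Measure.pi fun _ : Fin K × Fin M => stdComplexGaussian) := ⟨hc.aemeasurable, map_curry_pi _⟩
  have h3 : HasLaw (fun (z : Fin K → Fin M → ℂ) k => WithLp.toLp 2 (z k))
      (Measure.pi fun _ => gaussianVector M)
      (Measure.pi fun _ : Fin K => Measure.pi fun _ : Fin M => stdComplexGaussian) := by
    refine ⟨(measurable_pi_lambda _ fun k => (WithLp.measurable_toLp 2 _).comp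
      (measurable_pi_apply k)).aemeasurable, ?_⟩
    exact Measure.pi_map_pi (f := fun _ : Fin K => WithLp.toLp 2) fun _ => by fun_prop
  exact (h3.comp h2).comp h1

/-! ### Expected powers -/

lemma integrable_and_integral_eq_of_lintegral_ofReal {Ω : Type*} [MeasurableSpace Ω] {P : Measure Ω}
    {f : Ω → ℝ} (hf : AEMeasurable f P) (h0 : 0 ≤ᵐ[P] f) {c : ℝ} (hc : 0 ≤ c)
    (h : ∫⁻ ω, ENNReal.ofReal (f ω) ∂P = ENNReal.ofReal c) :
    Integrable f P ∧ ∫ ω, f ω ∂P = c := by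
  constructor
  · refine ⟨hf.aestronglyMeasurable, ?_⟩
    rw [hasFiniteIntegral_iff_ofReal h0, h]
    exact ENNReal.ofReal_lt_top
  · rw [integral_eq_lintegral_of_nonneg_ae h0 hf.aestronglyMeasurable, h, ENNReal.toReal_ofReal hc]

section Expectations

variable {Ω : Type*} [MeasurableSpace Ω] {P : Measure Ω} {m n : ℕ}
  {h : Fin (n + 2) → Ω → EuclideanSpace ℂ (Fin (m + 3))}

/-- The two selected channels are nonzero and not parallel, almost surely. -/
lemma ae_normBasedSelection_generic (hK : 2 ≤ n + 2)
    (hH : HasLaw (fun ω k => h k ω) (Measure.pi fun _ => gaussianVector (m + 3)) P) :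
    ∀ᵐ ω ∂P, (∀ i, normBasedSelection hK (fun k => h k ω) i ≠ 0) ∧
      cosSq (normBasedSelection hK (fun k => h k ω) 0)
        (normBasedSelection hK (fun k => h k ω) 1) < 1 := by
  have hgm := measurable_normBasedSelection (M := m + 3) hK
  have hne : ∀ᵐ h ∂(Measure.pi fun _ : Fin (n + 2) => gaussianVector (m + 3)), ∀ k, h k ≠ 0 := by
    refine ae_all_iff.2 fun k => ?_
    have h0 : ∀ᵐ y ∂(gaussianVector (m + 3)), y ≠ 0 := by
      rw [ae_iff]
      simpa using gaussianVector_norm_eq (m + 2) 0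
    exact (measurePreserving_eval (fun _ => gaussianVector (m + 3)) k).quasiMeasurePreserving.ae h0
  -- `1 / sin²` has a finite integral and is therefore finite almost everywhere
  have hcos : ∀ᵐ h ∂(Measure.pi fun _ : Fin (n + 2) => gaussianVector (m + 3)),
      cosSq (normBasedSelection hK h 0) (normBasedSelection hK h 1) < 1 := by
    have hfin := lintegral_strongest_div_sinSq m n hK (φ := fun _ => 1) measurable_const
    simp only [one_mul, lintegral_one, measure_univ, mul_one] at hfin
    have hlt := ae_lt_top (μ := Measure.pi fun _ : Fin (n + 2) => gaussianVector (m + 3))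
      (f := fun h => (ENNReal.ofReal
        (1 - cosSq (normBasedSelection hK h 0) (normBasedSelection hK h 1)))⁻¹)
      (by fun_prop) (by rw [hfin]; exact ENNReal.ofReal_ne_top)
    filter_upwards [hlt] with h hh
    rw [ENNReal.inv_lt_top, ENNReal.ofReal_pos] at hh
    linarith
  have hall := hne.and hcos
  rw [← hH.map_eq] at hall
  filter_upwards [ae_of_ae_map hH.aemeasurable hall] with ω hω
  exact ⟨fun i => hω.1 _, hω.2⟩

lemma aemeasurable_normBasedSelection (hK : 2 ≤ n + 2)
    (hH : HasLaw (fun ω k => h k ω) (Measure.pi fun _ => gaussianVector (m + 3)) P) (i : Fin 2) :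
    AEMeasurable (fun ω => normBasedSelection hK (fun k => h k ω) i) P :=
  ((measurable_pi_apply i).comp (measurable_normBasedSelection hK)).comp_aemeasurable
    hH.aemeasurable

lemma expectation_inv_normSq_strongest (hK : 2 ≤ n + 2)
    (hH : HasLaw (fun ω k => h k ω) (Measure.pi fun _ => gaussianVector (m + 3)) P) :
    Integrable (fun ω => 1 / ‖normBasedSelection hK (fun k => h k ω) 0‖ ^ 2) P ∧
      ∫ ω, 1 / ‖normBasedSelection hK (fun k => h k ω) 0‖ ^ 2 ∂P = alpha (m + 3) (n + 2) := by
  have hg0 := aemeasurable_normBasedSelection hK hH 0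
  have hgm := measurable_normBasedSelection (M := m + 3) hK
  refine integrable_and_integral_eq_of_lintegral_ofReal (by fun_prop)
    (ae_of_all _ fun ω => by simp only [Pi.zero_apply]; positivity)
    (alpha_nonneg (m + 1) (n + 1)) ?_
  rw [← lintegral_inv_normSq_strongest (m + 1) n hK]
  exact hH.lintegral_comp (f := fun h => ENNReal.ofReal (1 / ‖normBasedSelection hK h 0‖ ^ 2))
    (Measurable.aemeasurable (by fun_prop))

lemma expectation_inv_normSq_second (hK : 2 ≤ n + 2)
    (hH : HasLaw (fun ω k => h k ω) (Measure.pi fun _ => gaussianVector (m + 3)) P) :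
    Integrable (fun ω => 1 / ‖normBasedSelection hK (fun k => h k ω) 1‖ ^ 2) P ∧
      ∫ ω, 1 / ‖normBasedSelection hK (fun k => h k ω) 1‖ ^ 2 ∂P =
        ((n : ℝ) + 2) * alpha (m + 3) (n + 1) - (n + 1) * alpha (m + 3) (n + 2) := by
  have hg1 := aemeasurable_normBasedSelection hK hH 1
  have hgm := measurable_normBasedSelection (M := m + 3) hK
  refine integrable_and_integral_eq_of_lintegral_ofReal (by fun_prop)
    (ae_of_all _ fun ω => by simp only [Pi.zero_apply]; positivity)
    (mul_alpha_sub_mul_alpha_nonneg (m + 1) n) ?_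
  rw [← lintegral_inv_normSq_second (m + 1) n hK]
  exact hH.lintegral_comp (f := fun h => ENNReal.ofReal (1 / ‖normBasedSelection hK h 1‖ ^ 2))
    (Measurable.aemeasurable (by fun_prop))

/-- The factor `1 / sin² θ₁` contributes `(M - 1) / (M - 2)` to the expectation of its product with
any function of the largest norm. -/
lemma expectation_strongest_div_sinSq (hK : 2 ≤ n + 2)
    (hH : HasLaw (fun ω k => h k ω) (Measure.pi fun _ => gaussianVector (m + 3)) P)
    {f : ℝ → ℝ} (hf : Measurable f) (hf0 : ∀ s, 0 ≤ s → 0 ≤ f s)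
    (hint : Integrable (fun ω => f (‖normBasedSelection hK (fun k => h k ω) 0‖ ^ 2)) P) :
    Integrable (fun ω => f (‖normBasedSelection hK (fun k => h k ω) 0‖ ^ 2) *
      (1 / (1 - cosSq (normBasedSelection hK (fun k => h k ω) 0)
        (normBasedSelection hK (fun k => h k ω) 1)))) P ∧
    ∫ ω, f (‖normBasedSelection hK (fun k => h k ω) 0‖ ^ 2) *
      (1 / (1 - cosSq (normBasedSelection hK (fun k => h k ω) 0)
        (normBasedSelection hK (fun k => h k ω) 1))) ∂P =
      ((m : ℝ) + 2) / (m + 1) * ∫ ω, f (‖normBasedSelection hK (fun k => h k ω) 0‖ ^ 2) ∂P := by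
  have hg0 := aemeasurable_normBasedSelection hK hH 0
  have hg1 := aemeasurable_normBasedSelection hK hH 1
  have hgm := measurable_normBasedSelection (M := m + 3) hK
  have hpos : ∀ ω, 0 ≤ f (‖normBasedSelection hK (fun k => h k ω) 0‖ ^ 2) :=
    fun ω => hf0 _ (by positivity)
  have hc : 0 ≤ ∫ ω, f (‖normBasedSelection hK (fun k => h k ω) 0‖ ^ 2) ∂P := integral_nonneg hpos
  refine integrable_and_integral_eq_of_lintegral_ofReal (by fun_prop)
    (ae_of_all _ fun ω => ?_) (by positivity) ?_
  · exact mul_nonneg (hpos ω) (one_div_nonneg.2 (sub_nonneg.2 (cosSq_le_one _ _)))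
  rw [ENNReal.ofReal_mul (by positivity),
    ofReal_integral_eq_lintegral_ofReal hint (ae_of_all _ hpos)]
  have h1 := lintegral_strongest_div_sinSq m n hK (φ := fun s => ENNReal.ofReal (f s)) (by fun_prop)
  rw [← hH.lintegral_comp (Measurable.aemeasurable (by fun_prop)),
    ← hH.lintegral_comp (Measurable.aemeasurable (by fun_prop))] at h1
  rw [← h1]
  refine lintegral_congr_ae ?_
  filter_upwards [ae_normBasedSelection_generic hK hH] with ω hω
  rw [ENNReal.ofReal_mul (hpos ω), one_div, ENNReal.ofReal_inv_of_pos (by linarith [hω.2])]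

/-- The exact minimum transmit power, divided by the SINR target, is dominated by its limit. -/
lemma abs_pairPower_div_le {noise γ : ℝ} (hn : 0 < noise) (hγ : 0 < γ) {M : ℕ}
    {a b : EuclideanSpace ℂ (Fin M)} (hab : cosSq a b < 1) :
    |pairPower noise γ a b / γ| ≤
      noise * (1 / ‖b‖ ^ 2 + 1 / ‖a‖ ^ 2 * (1 / (1 - cosSq a b))) := by
  have ht := one_sub_mul_cosSq_pos hγ a b
  have hle : 1 - cosSq a b ≤ 1 - γ / (1 + γ) * cosSq a b := by
    have h1 : γ / (1 + γ) ≤ 1 := by rw [div_le_one (by linarith)]; linarith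
    have := mul_le_of_le_one_left (cosSq_nonneg a b) h1
    linarith
  have e : pairPower noise γ a b / γ =
      noise * (1 / ‖b‖ ^ 2 + 1 / ‖a‖ ^ 2 * (1 / (1 - γ / (1 + γ) * cosSq a b))) := by
    rw [pairPower, one_div_mul_one_div]
    field_simp
  rw [e, abs_of_nonneg (by positivity)]
  have := one_div_le_one_div_of_le (sub_pos.2 hab) hle
  gcongr

end Expectations

lemma tendsto_pairPower_div {noise : ℝ} {M : ℕ} {a b : EuclideanSpace ℂ (Fin M)}
    (hab : cosSq a b < 1) :
    Tendsto (fun γ => pairPower noise γ a b / γ) atTop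
      (𝓝 (noise * (1 / ‖b‖ ^ 2 + 1 / ‖a‖ ^ 2 * (1 / (1 - cosSq a b))))) := by
  have hκ : Tendsto (fun γ : ℝ => γ / (1 + γ)) atTop (𝓝 1) := by
    have h1 : Tendsto (fun γ : ℝ => 1 - (1 + γ)⁻¹) atTop (𝓝 (1 - 0)) :=
      tendsto_const_nhds.sub (tendsto_inv_atTop_zero.comp
        (tendsto_atTop_add_const_left _ 1 tendsto_id))
    rw [sub_zero] at h1
    refine h1.congr' ?_
    filter_upwards [eventually_gt_atTop 0] with γ hγ
    field_simp
    ring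
  have h2 : Tendsto (fun γ : ℝ => 1 - γ / (1 + γ) * cosSq a b) atTop (𝓝 (1 - cosSq a b)) := by
    simpa using tendsto_const_nhds.sub (hκ.mul_const (cosSq a b))
  have h3 := (((tendsto_const_nhds (x := (1 : ℝ))).div h2 (sub_pos.2 hab).ne').const_mul
    (1 / ‖a‖ ^ 2)).const_add (1 / ‖b‖ ^ 2)
  refine (h3.const_mul noise).congr' ?_
  filter_upwards [eventually_gt_atTop 0] with γ hγ
  simp only [Pi.div_apply]
  rw [pairPower, one_div_mul_one_div]
  field_simp

end MultiuserDownlink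

end

theorem mainTheorem7 {Ω : Type*} [MeasurableSpace Ω] (P : Measure Ω) [IsProbabilityMeasure P]
    (M K : ℕ) (hM : 3 ≤ M) (hK : 2 ≤ K)
    (h : Fin K → Ω → EuclideanSpace ℂ (Fin M))
    (hlaw : ∀ k m, HasLaw (fun ω => h k ω m) MultiuserDownlink.stdComplexGaussian P)
    (hindep : iIndepFun (fun (km : Fin K × Fin M) (ω : Ω) => h km.1 ω km.2) P)
    (σ : ℝ) (hσ : 0 < σ)
    (g : Ω → Fin 2 → EuclideanSpace ℂ (Fin M))
    (hg : g = fun ω => MultiuserDownlink.normBasedSelection hK (fun k => h k ω)) :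
    -- average minimum transmit power, weaker user first
    (∀ γ : ℝ, 0 < γ →
      Integrable (fun ω => MultiuserDownlink.largeSINRPower (σ ^ 2) γ (g ω ∘ Fin.rev)) P ∧
      ∫ ω, MultiuserDownlink.largeSINRPower (σ ^ 2) γ (g ω ∘ Fin.rev) ∂P =
        γ * σ ^ 2 * (K * MultiuserDownlink.alpha M (K - 1) -
          ((K : ℝ) - 2 - 1 / ((M : ℝ) - 2)) * MultiuserDownlink.alpha M K)) ∧
    -- the exact minimum over orders, beamforming vectors and powers, for large SINR targets
    (∀ γ : ℝ, 0 < γ →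
      Integrable (fun ω => MultiuserDownlink.minTransmitPower (σ ^ 2) γ (g ω)) P) ∧
    Tendsto (fun γ : ℝ => (∫ ω, MultiuserDownlink.minTransmitPower (σ ^ 2) γ (g ω) ∂P) / γ) atTop
      (𝓝 (σ ^ 2 * (K * MultiuserDownlink.alpha M (K - 1) -
          ((K : ℝ) - 2 - 1 / ((M : ℝ) - 2)) * MultiuserDownlink.alpha M K))) ∧
    -- the expectations for the two largest norms and for the angle
    (Integrable (fun ω => 1 / ‖g ω 0‖ ^ 2) P ∧
      ∫ ω, 1 / ‖g ω 0‖ ^ 2 ∂P = MultiuserDownlink.alpha M K) ∧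
    (Integrable (fun ω => 1 / ‖g ω 1‖ ^ 2) P ∧
      ∫ ω, 1 / ‖g ω 1‖ ^ 2 ∂P =
        K * MultiuserDownlink.alpha M (K - 1) - ((K : ℝ) - 1) * MultiuserDownlink.alpha M K) ∧
    (Integrable (fun ω => 1 / Real.sin (MultiuserDownlink.angleToSubspace (g ω 0)
        (Submodule.span ℂ {g ω 1})) ^ 2) P ∧
      ∫ ω, 1 / Real.sin (MultiuserDownlink.angleToSubspace (g ω 0)
        (Submodule.span ℂ {g ω 1})) ^ 2 ∂P = ((M : ℝ) - 1) / ((M : ℝ) - 2)) := by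
  obtain ⟨m, rfl⟩ : ∃ m, M = m + 3 := ⟨M - 3, by omega⟩
  obtain ⟨n, rfl⟩ : ∃ n, K = n + 2 := ⟨K - 2, by omega⟩
  have hH := MultiuserDownlink.hasLaw_channels hlaw hindep
  have hg0 : AEMeasurable (fun ω => g ω 0) P := by
    rw [hg]; exact MultiuserDownlink.aemeasurable_normBasedSelection hK hH 0
  have hg1 : AEMeasurable (fun ω => g ω 1) P := by
    rw [hg]; exact MultiuserDownlink.aemeasurable_normBasedSelection hK hH 1
  have hgen : ∀ᵐ ω ∂P, (∀ i, g ω i ≠ 0) ∧ MultiuserDownlink.cosSq (g ω 0) (g ω 1) < 1 := by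
    rw [hg]; exact MultiuserDownlink.ae_normBasedSelection_generic hK hH
  have hle : ∀ ω, ‖g ω 1‖ ≤ ‖g ω 0‖ := fun ω => by
    rw [hg]; exact MultiuserDownlink.norm_normBasedSelection_antitone hK _ (Fin.zero_le 1)
  obtain ⟨hi0, he0⟩ : Integrable (fun ω => 1 / ‖g ω 0‖ ^ 2) P ∧
      ∫ ω, 1 / ‖g ω 0‖ ^ 2 ∂P = MultiuserDownlink.alpha (m + 3) (n + 2) := by
    rw [hg]; exact MultiuserDownlink.expectation_inv_normSq_strongest hK hH
  obtain ⟨hi1, he1⟩ : Integrable (fun ω => 1 / ‖g ω 1‖ ^ 2) P ∧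
      ∫ ω, 1 / ‖g ω 1‖ ^ 2 ∂P = ((n : ℝ) + 2) * MultiuserDownlink.alpha (m + 3) (n + 1) -
        (n + 1) * MultiuserDownlink.alpha (m + 3) (n + 2) := by
    rw [hg]; exact MultiuserDownlink.expectation_inv_normSq_second hK hH
  obtain ⟨hiA, heA⟩ : Integrable
        (fun ω => 1 / (1 - MultiuserDownlink.cosSq (g ω 0) (g ω 1))) P ∧
      ∫ ω, 1 / (1 - MultiuserDownlink.cosSq (g ω 0) (g ω 1)) ∂P = ((m : ℝ) + 2) / (m + 1) := by
    have := MultiuserDownlink.expectation_strongest_div_sinSq hK hH (f := fun _ => 1)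
      measurable_const (fun _ _ => zero_le_one) (integrable_const _)
    simpa [hg] using this
  obtain ⟨hiB, heB⟩ : Integrable (fun ω => 1 / ‖g ω 0‖ ^ 2 *
        (1 / (1 - MultiuserDownlink.cosSq (g ω 0) (g ω 1)))) P ∧
      ∫ ω, 1 / ‖g ω 0‖ ^ 2 * (1 / (1 - MultiuserDownlink.cosSq (g ω 0) (g ω 1))) ∂P =
        ((m : ℝ) + 2) / (m + 1) * MultiuserDownlink.alpha (m + 3) (n + 2) := by
    have := MultiuserDownlink.expectation_strongest_div_sinSq hK hH (f := fun s => 1 / s)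
      (by fun_prop) (fun s hs => one_div_nonneg.2 hs) (by rw [hg] at hi0; exact hi0)
    rw [← he0, hg]
    exact this
  -- the large-SINR power for `σ ^ 2 = γ = 1`
  have hlim : ∫ ω, (1 / ‖g ω 1‖ ^ 2 + 1 / ‖g ω 0‖ ^ 2 *
        (1 / (1 - MultiuserDownlink.cosSq (g ω 0) (g ω 1)))) ∂P =
      ((n + 2 : ℕ) : ℝ) * MultiuserDownlink.alpha (m + 3) (n + 2 - 1) -
        (((n + 2 : ℕ) : ℝ) - 2 - 1 / (((m + 3 : ℕ) : ℝ) - 2)) *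
          MultiuserDownlink.alpha (m + 3) (n + 2) := by
    rw [integral_add hi1 hiB, he1, heB, show n + 2 - 1 = n + 1 from rfl]
    push_cast
    rw [show (m : ℝ) + 3 - 2 = m + 1 by ring]
    field_simp
    ring
  have hmin : ∀ γ : ℝ, 0 < γ → (fun ω => MultiuserDownlink.minTransmitPower (σ ^ 2) γ (g ω)) =ᵐ[P]
      fun ω => MultiuserDownlink.pairPower (σ ^ 2) γ (g ω 0) (g ω 1) := by
    intro γ hγ
    filter_upwards [hgen] with ω hω
    exact MultiuserDownlink.minTransmitPower_eq_pairPower (by positivity) hγ (hω.1 1) (hle ω)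
  have hmeas : ∀ γ : ℝ, AEMeasurable
      (fun ω => MultiuserDownlink.pairPower (σ ^ 2) γ (g ω 0) (g ω 1)) P := by
    intro γ
    unfold MultiuserDownlink.pairPower
    fun_prop
  have hdom : Integrable (fun ω => σ ^ 2 * (1 / ‖g ω 1‖ ^ 2 + 1 / ‖g ω 0‖ ^ 2 *
      (1 / (1 - MultiuserDownlink.cosSq (g ω 0) (g ω 1))))) P := (hi1.add hiB).const_mul _
  have hbound : ∀ γ : ℝ, 0 < γ → ∀ᵐ ω ∂P,
      ‖MultiuserDownlink.pairPower (σ ^ 2) γ (g ω 0) (g ω 1) / γ‖ ≤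
        σ ^ 2 * (1 / ‖g ω 1‖ ^ 2 + 1 / ‖g ω 0‖ ^ 2 *
          (1 / (1 - MultiuserDownlink.cosSq (g ω 0) (g ω 1)))) := by
    intro γ hγ
    filter_upwards [hgen] with ω hω
    exact MultiuserDownlink.abs_pairPower_div_le (by positivity) hγ hω.2
  refine ⟨fun γ hγ => ?_, fun γ hγ => ?_, ?_, ⟨hi0, he0⟩, ⟨hi1, ?_⟩, ?_⟩
  · simp_rw [MultiuserDownlink.largeSINRPower_rev]
    refine ⟨(hi1.add hiB).const_mul _, ?_⟩
    rw [integral_const_mul, hlim, mul_comm γ]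
  · rw [integrable_congr (hmin γ hγ)]
    have h1 : Integrable (fun ω => MultiuserDownlink.pairPower (σ ^ 2) γ (g ω 0) (g ω 1) / γ) P :=
      hdom.mono' ((hmeas γ).div_const γ).aestronglyMeasurable (hbound γ hγ)
    refine (h1.const_mul γ).congr (ae_of_all _ fun ω => ?_)
    exact mul_div_cancel₀ _ hγ.ne'
  · -- dominated convergence: the power divided by `γ` is at most its pointwise limit
    rw [← hlim, ← integral_const_mul]
    have htend := tendsto_integral_filter_of_dominated_convergence (l := atTop) (μ := P)
      (F := fun (γ : ℝ) ω => MultiuserDownlink.pairPower (σ ^ 2) γ (g ω 0) (g ω 1) / γ) _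
      (Eventually.of_forall fun γ => ((hmeas γ).div_const γ).aestronglyMeasurable)
      ((eventually_gt_atTop 0).mono hbound) hdom
      (hgen.mono fun ω hω => MultiuserDownlink.tendsto_pairPower_div hω.2)
    refine htend.congr' ?_
    filter_upwards [eventually_gt_atTop 0] with γ hγ
    rw [integral_div, integral_congr_ae (hmin γ hγ)]
  · rw [he1, show n + 2 - 1 = n + 1 from rfl]
    push_cast
    ring
  · simp_rw [MultiuserDownlink.sin_angleToSubspace_span_singleton_sq]
    refine ⟨hiA, heA.trans ?_⟩
    push_cast
    rw [show (m : ℝ) + 3 - 2 = m + 1 by ring, show (m : ℝ) + 3 - 1 = m + 2 by ring]
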